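/- Let $\Phi$ be a reduced crystallographic root system (not necessarily irreducible) spanning a finite-dimensional real vector space $V$, let $N$ be a real vector space in perfect duality $\langle\cdot,\cdot\rangle$ with $V$ (for instance $N=V$ with an inner product), containing the coroots $\alpha^\vee$, and extend the pairing complex-linearly to $V_{\mathbb C}\times N$. Let $\Delta=\{\alpha_1,\dots,\alpha_r\}$ be a fundamental system, $\Phi_+$ the positive roots, $\Phi_-=-\Phi_+$, $\lambda_1,\dots,\lambda_r\in V$ the fundamental weights ($\langle\lambda_j,\alpha_i^\vee\rangle=\delta_{ij}$), $\rho=\frac12\sum_{\alpha\in\Phi_+}\alpha$, $W$ the Weyl group, $\Phi_w=\Phi_+\cap w^{-1}\Phi_-$ for $w\in W$, and $w_0$ the longest element of $W$ (the one with $|\Phi_w|$ maximal). Let $\mathrm{Aut}(\Gamma)$ be the group of automorphisms of the Dynkin diagram $\Gamma$, that is, the permutations $\varpi$ of $\{1,\dots,r\}$ preserving the Cartan integers; $\varpi$ acts linearly on $V$ by $\alpha_i\mapsto\alpha_{\varpi i}$ and on $N$ by $\alpha_i^\vee\mapsto\alpha_{\varpi i}^\vee$. Put $\xi(s)=\pi^{-s/2}\Gamma(s/2)\zeta(s)$.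 For $\lambda\in V_{\mathbb C}$ and $T\in N$ let $$\omega(\lambda;T)=\sum_{w\in W}e^{\langle w\lambda-\rho,T\rangle}\prod_{\alpha\in\Delta}\frac1{\langle w\lambda-\rho,\alpha^\vee\rangle}\prod_{\alpha\in\Phi_w}\frac{\xi(\langle\lambda,\alpha^\vee\rangle)}{\xi(\langle\lambda,\alpha^\vee\rangle+1)}.$$ Fix $p\in\{1,\dots,r\}$ (a maximal parabolic subgroup $P$), put $\Delta_p=\Delta\setminus\{\alpha_p\}=\{\beta_1,\dots,\beta_{r-1}\}$, in any order, and define, in the coordinates $s_k=\langle\lambda-\rho,\alpha_k^\vee\rangle$ with $s=s_p$, the iterated residue $$\omega^{G/P}_{\mathbb Q}(s;T)=\operatorname{Res}_{\langle\lambda-\rho,\beta_1^\vee\rangle=0}\cdots\operatorname{Res}_{\langle\lambda-\rho,\beta_{r-1}^\vee\rangle=0}\ \omega(\lambda;T).$$ Up to exponential and rational factors, it is a sum, over the $w\in W$ with $\Delta_p\subset w^{-1}(\Delta\cup\Phi_-)$, of the terms $$\prod_{\alpha\in\Phi_w\setminus\Delta_p}\xi(\langle\lambda_p,\alpha^\vee\rangle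 s+\langle\rho,\alpha^\vee\rangle)\Big/\prod_{\alpha\in\Phi_w}\xi(\langle\lambda_p,\alpha^\vee\rangle s+\langle\rho,\alpha^\vee\rangle+1).$$ For integers $k\ge0$, $h\ge2$ let $M_p(k,h)$ be the least non-negative integer $m$ such that, for each of these $w$, the factor $\xi(ks+h)$ occurs in the denominator of the displayed term at most $m$ times more often than in its numerator (factors being counted formally, without cancellation). Weng's zeta function is $$\xi^{G/P}_{\mathbb Q;o}(s;T)=\omega^{G/P}_{\mathbb Q}(s;T)\prod_{k\ge0}\prod_{h\ge2}\xi(ks+h)^{M_p(k,h)},$$ a product with only finitely many non-trivial factors. Let $\Phi_{p+}=\{\alpha\in\Phi_+:\langle\lambda_p,\alpha^\vee\rangle=0\}$, $\rho_p=\frac12\sum_{\alpha\in\Phi_{p+}}\alpha$ and $c_p=2\langle\lambda_p-\rho_p,\alpha_p^\vee\rangle$. **Theorem (Functional equations).** For every $T\in N$, the function $\xi^{G/P}_{\mathbb Q;o}(s;T)$ is meromorphic on $\mathbb C$ and, as a meromorphic function, independent of the order of $\Delta_p$. There is $\varpi_0\in\mathrm{Aut}(\Gamma)$ with $-\mathrm{Id}=\varpi_0w_0$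 on $V$, and, as an identity of meromorphic functions of $s$, $$\xi^{G/P}_{\mathbb Q;o}(-c_p-s;\varpi_0T)=\xi^{G/P}_{\mathbb Q;o}(s;T).$$ Moreover, for every $\varpi\in\mathrm{Aut}(\Gamma)$, if $q=\varpi p$ and $Q$ is the maximal parabolic subgroup corresponding to $q$, then $$\xi^{G/P}_{\mathbb Q;o}(s;T)=\xi^{G/Q}_{\mathbb Q;o}(s;\varpi T).$$ -/

import Mathlib

open scoped TensorProduct Topology

set_option linter.unusedSectionVars false

noncomputable section

namespace Weng

section

variable {ι V N : Type*} [Fintype ι] [AddCommGroup V] [Module ℝ V] [AddCommGroup N] [Module ℝ N]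
  {P : RootPairing ι ℝ V N} (b : P.Base)

/-! ### Root systems -/

/-- The permutation of the (indices of the) roots induced by an element of the Weyl group. -/
abbrev perm (w : P.weylGroup) : Equiv.Perm ι := P.weylGroupToPerm w

open Classical in
/-- `Φ₊`, as a set of indices. -/
def posRoots : Finset ι := Finset.univ.filter fun i => b.IsPos i

open Classical in
/-- `Φ_w = Φ₊ ∩ w⁻¹Φ₋`, as a set of indices. -/
def inversions (w : P.weylGroup) : Finset ι :=
  Finset.univ.filter fun i => b.IsPos i ∧ ¬ b.IsPos (perm w i)

/-- The length `l(w) = |Φ_w|`. -/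
def length (w : P.weylGroup) : ℕ := (inversions b w).card

/-- `w` is the longest element of the Weyl group. -/
def IsLongest (w : P.weylGroup) : Prop := ∀ v : P.weylGroup, length b v ≤ length b w

/-- The Weyl vector `ρ`, half the sum of the positive roots. -/
def rho : V := (2⁻¹ : ℝ) • ∑ i ∈ posRoots b, P.root i

section

variable [P.IsRootSystem]

/-- The fundamental weight `λ_j`, see `fundamentalWeight_pairing`. -/
def fundamentalWeight (j : b.support) : V :=
  P.toLinearMap.toPerfPair.symm (b.toCoweightBasis.coord j)

open Classical in
/-- `⟨λ_j, α_i^∨⟩ = δ_ij`. -/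
theorem fundamentalWeight_pairing (i j : b.support) :
    P.toLinearMap (fundamentalWeight b j) (P.coroot i) = if i = j then 1 else 0 := by
  rw [fundamentalWeight, LinearMap.apply_symm_toPerfPair_self, ← b.toCoweightBasis_apply,
    Module.Basis.coord_apply, Module.Basis.repr_self, Finsupp.single_apply]

open Classical in
/-- `Φ_{p+}`: the positive roots of the root system `Φ_p` normal to `λ_p`. -/
def posRootsNormal (p : b.support) : Finset ι :=
  (posRoots b).filter fun i => P.toLinearMap (fundamentalWeight b p) (P.coroot i) = 0

/-- `ρ_p`, half the sum of the positive roots of `Φ_p`. -/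
def rhoNormal (p : b.support) : V := (2⁻¹ : ℝ) • ∑ i ∈ posRootsNormal b p, P.root i

/-- `c_p = 2⟨λ_p - ρ_p, α_p^∨⟩`. -/
def center (p : b.support) : ℝ :=
  2 * P.toLinearMap (fundamentalWeight b p - rhoNormal b p) (P.coroot p)

/-! ### Automorphisms of the Dynkin diagram -/

/-- A permutation of the simple roots is an automorphism of the Dynkin diagram (with its
multiplicities and arrows) if and only if it preserves the Cartan integers. -/
def IsDiagramAut [P.IsCrystallographic] (ϖ : Equiv.Perm b.support) : Prop :=
  ∀ i j, b.cartanMatrix (ϖ i) (ϖ j) = b.cartanMatrix i j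

/-- The action on `V`: the simple root `α_i` is sent to `α_{ϖ i}`. -/
def autV (ϖ : Equiv.Perm b.support) : V ≃ₗ[ℝ] V :=
  b.toWeightBasis.equiv b.toWeightBasis ϖ

/-- The action on the dual space `N`: the simple coroot `α_i^∨` is sent to `α_{ϖ i}^∨`. -/
def autN (ϖ : Equiv.Perm b.support) : N ≃ₗ[ℝ] N :=
  b.toCoweightBasis.equiv b.toCoweightBasis ϖ

end

/-! ### The period -/

/-- The pairing `⟨λ, y⟩`, extended complex-linearly to `λ` in the complexification of `V`. -/
def pairC (P : RootPairing ι ℝ V N) (lam : ℂ ⊗[ℝ] V) (y : N) : ℂ :=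
  TensorProduct.AlgebraTensorModule.rid ℝ ℂ ℂ ((P.toLinearMap.flip y).baseChange ℂ lam)

theorem pairC_tmul (z : ℂ) (v : V) (y : N) :
    pairC P (z ⊗ₜ[ℝ] v) y = (P.toLinearMap v y : ℝ) * z := by
  simp [pairC]

/-- The action of the Weyl group on the complexification of `V`. -/
def actC (w : P.weylGroup) : ℂ ⊗[ℝ] V →ₗ[ℂ] ℂ ⊗[ℝ] V :=
  (P.weylGroupRootRep w).baseChange ℂ

/-- The completed zeta function `ξ(s) = π^(-s/2) Γ(s/2) ζ(s)`. -/
abbrev xi (s : ℂ) : ℂ := completedRiemannZeta s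

/-- The period `ω^G_ℚ(λ; T)`. -/
def period (lam : ℂ ⊗[ℝ] V) (T : N) : ℂ :=
  ∑ᶠ w : P.weylGroup,
    Complex.exp (pairC P (actC w lam - 1 ⊗ₜ[ℝ] rho b) T) *
    (∏ i ∈ b.support, 1 / pairC P (actC w lam - 1 ⊗ₜ[ℝ] rho b) (P.coroot i)) *
    ∏ i ∈ inversions b w, xi (pairC P lam (P.coroot i)) / xi (pairC P lam (P.coroot i) + 1)

/-! ### Iterated residues -/

/-- The residue of `f` at `c`: the value, for all small `r > 0`, of
`(2πi)⁻¹ ∮_{|z - c| = r} f(z) dz`. -/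
def residue (f : ℂ → ℂ) (c : ℂ) : ℂ :=
  Filter.limUnder (𝓝[>] (0 : ℝ)) fun r =>
    (2 * Real.pi * Complex.I)⁻¹ * ∮ z in C(c, r), f z

open Classical in
/-- For `l = [k₁, …, kₘ]`, the iterated residue `Res_{s_{k₁} = 0} ⋯ Res_{s_{kₘ} = 0} F`, as a
function of the remaining coordinates. The innermost residue is that in `s_{kₘ}`. -/
def iteratedResidue {κ : Type*} (F : (κ → ℂ) → ℂ) : List κ → (κ → ℂ) → ℂ
  | [], s => F s
  | k :: l, s => residue (fun z => iteratedResidue F l (Function.update s k z)) 0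

section

variable [P.IsRootSystem]

/-- `l` is an ordering of `Δ_p = Δ ∖ {α_p}`. -/
def IsOrdering (p : b.support) (l : List b.support) : Prop :=
  l.Nodup ∧ ∀ j, j ∈ l ↔ j ≠ p

/-- The point `λ = ρ + ∑ s_k λ_k`, that is, the point with `⟨λ - ρ, α_k^∨⟩ = s_k`. -/
def point (s : b.support → ℂ) : ℂ ⊗[ℝ] V :=
  1 ⊗ₜ[ℝ] rho b + ∑ k, s k ⊗ₜ[ℝ] fundamentalWeight b k

open Classical in
/-- `ω^{G/P}_ℚ(s; T)`: the iterated residue of the period along `⟨λ - ρ, β^∨⟩ = 0`, `β ∈ Δ_p`,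
taken in the order `l`, as a function of `s = ⟨λ - ρ, α_p^∨⟩`. -/
def residuePeriod (p : b.support) (l : List b.support) (T : N) (s : ℂ) : ℂ :=
  iteratedResidue (fun t => period b (point b t) T) l (Pi.single p s)

/-! ### The minimal factor and the zeta function -/

/-- `Δ_p ⊂ w⁻¹(Δ ∪ Φ₋)`: the condition under which the term of `w` survives the residues. -/
def Survives (p : b.support) (w : P.weylGroup) : Prop :=
  ∀ j : b.support, j ≠ p → (perm w j ∈ b.support ∨ ¬ b.IsPos (perm w j))

open Classical in
/-- The number of factors `ξ(ks + h)` in the numerator of the term of `w` in `ω^{G/P}_ℚ(s; T)`,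
which is `∏_{α ∈ Φ_w ∖ Δ_p} ξ(⟨λ_p, α^∨⟩ s + ht α^∨)`, with `ht α^∨ = ⟨ρ, α^∨⟩`. -/
def numeratorCount (p : b.support) (w : P.weylGroup) (k h : ℕ) : ℕ :=
  ((inversions b w).filter fun i => ¬ (i ∈ b.support ∧ i ≠ p) ∧
    P.toLinearMap (fundamentalWeight b p) (P.coroot i) = k ∧
    P.toLinearMap (rho b) (P.coroot i) = h).card

open Classical in
/-- The number of factors `ξ(ks + h)` in the denominator of the term of `w` in `ω^{G/P}_ℚ(s; T)`,
which is `∏_{α ∈ Φ_w} ξ(⟨λ_p, α^∨⟩ s + ht α^∨ + 1)`. -/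
def denominatorCount (p : b.support) (w : P.weylGroup) (k h : ℕ) : ℕ :=
  ((inversions b w).filter fun i =>
    P.toLinearMap (fundamentalWeight b p) (P.coroot i) = k ∧
    P.toLinearMap (rho b) (P.coroot i) + 1 = h).card

/-- The least number `M_p(k, h)` of factors `ξ(ks + h)` by which `ω^{G/P}_ℚ(s; T)` has to be
multiplied in order that `ξ(ks + h)` is cancelled from the denominator of each of its terms. -/
def minimalExponent (p : b.support) (k h : ℕ) : ℕ :=
  sInf {m : ℕ | ∀ w : P.weylGroup, Survives b p w →
    denominatorCount b p w k h ≤ m + numeratorCount b p w k h}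

/-- Weng's zeta function `ξ^{G/P}_{ℚ;o}(s; T)`, with the residues taken in the order `l`. The
product has finitely many factors different from `1`. -/
def wengZeta (p : b.support) (l : List b.support) (T : N) (s : ℂ) : ℂ :=
  residuePeriod b p l T s *
    ∏ᶠ (kh : ℕ × ℕ) (_ : 2 ≤ kh.2), xi (kh.1 * s + kh.2) ^ minimalExponent b p kh.1 kh.2

end

end

end Weng

end

/-! Work on the line λ = ρ + s λ_p, where the residues are taken. In the term of `w`, a root β of
Δ_p can cause a pole along ⟨λ - ρ, β^∨⟩ = 0 in two mutually exclusive ways: wβ is simple (a rational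
factor) or wβ is negative (the pole of ξ at 1). So these poles are simple. Multiplied by the
coordinates of Δ_p, the period is holomorphic near a generic point of the line, and the iterated
residue is the value of that product (`residuePeriod_eq_residueSum`). Terms with some wβ positive
but not simple vanish, and the order of Δ_p is irrelevant.

Let w_p be the longest element of the Weyl group of Φ_p. It negates Φ_{p+}, permutes the other
positive roots and satisfies w_p ρ = c_p λ_p - ρ, whence w_p(ρ + s λ_p) = -(ρ + (-c_p - s) λ_p).
With ϖ₀ = -w₀⁻¹, the bijection w ↦ w₀⁻¹ w w_p, combined with s ↦ -c_p - s and T ↦ ϖ₀T, respects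
survival and the exponential and rational factors. Call the coefficient of α_p^∨ in a coroot its
level. The ξ-factors of level 0 are also respected; at other levels Φ_w is replaced by its
complement in Φ₊. By ξ(1 - z) = ξ(z), every term is therefore multiplied by the same quotient ∏ ξ(a
+ 1)/ξ(a), with a = ⟨λ, α^∨⟩ and α running over the positive roots of non-zero level
(`residueSum_mul_prod`).

Taking complements in the counts that define M_p gives, for k ≠ 0, M_p(k, c_p k + 1 - h) - M_p(k, h)
= N(k, h) - N(k, h - 1), where N counts positive roots by level and height (`exponentAt_add`). Hence
the minimal factor is multiplied by the inverse quotient (`minimalFactor_mul_prod`).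

A diagram automorphism extends to the root system and carries the term of `w` to that of its
conjugate; the trivial one gives independence of the order. The identities are proved at generic s,
which suffices for meromorphic functions. -/

noncomputable section

namespace Weng

/-! ### Negation and positivity of roots -/

section

section Negation

variable {ι V N : Type*} [AddCommGroup V] [Module ℝ V] [AddCommGroup N] [Module ℝ N]
  (P : RootPairing ι ℝ V N)

/-- The index of the negative of a root. -/
def neg : Equiv.Perm ι where
  toFun i := P.reflectionPerm i i
  invFun i := P.reflectionPerm i i
  left_inv i := by let := P.indexNeg; exact neg_neg i
  right_inv i := by let := P.indexNeg; exact neg_neg i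

@[simp] lemma neg_neg_apply (i : ι) : neg P (neg P i) = i := (neg P).left_inv i

@[simp] lemma root_neg (i : ι) : P.root (neg P i) = -P.root i := by simp [neg]

@[simp] lemma coroot_neg (i : ι) : P.coroot (neg P i) = -P.coroot i := by simp [neg]

lemma pairing_neg_neg (i j : ι) : P.pairing (neg P i) (neg P j) = P.pairing i j := by
  rw [← P.root_coroot_eq_pairing, root_neg, coroot_neg]; simp

variable {P}

lemma isPos_neg_iff (b : P.Base) (i : ι) : b.IsPos (neg P i) ↔ ¬ b.IsPos i :=
  RootPairing.Base.IsPos.neg_iff_not b i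

lemma root_indexEquiv (g : P.Aut) (i : ι) : P.root (g.indexEquiv i) = g • P.root i :=
  RootPairing.Equiv.root_indexEquiv_eq_smul P i g

lemma indexEquiv_neg (g : P.Aut) (i : ι) :
    g.indexEquiv (neg P i) = neg P (g.indexEquiv i) :=
  P.root.injective <| by rw [root_indexEquiv, root_neg, smul_neg, root_neg, root_indexEquiv]

/-- `coweightMap` is the transpose of the action on weights, so on coroots it acts as the inverse of
`g`. -/
lemma toLinearMap_aut_smul (g : P.Aut) (x : V) (y : N) :
    P.toLinearMap (g • x) y = P.toLinearMap x (g.coweightMap y) := by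
  have := RootPairing.Hom.weight_coweight_transpose_apply P P y g.toHom
  exact LinearMap.congr_fun this x

lemma toLinearMap_aut_smul_coroot (g : P.Aut) (x : V) (i : ι) :
    P.toLinearMap (g • x) (P.coroot (g.indexEquiv i)) = P.toLinearMap x (P.coroot i) := by
  rw [toLinearMap_aut_smul]
  have := RootPairing.Hom.coroot_coweightMap_apply P P (g.indexEquiv i) g.toHom
  rw [this, Equiv.symm_apply_apply]

lemma perm_neg (w : P.weylGroup) (i : ι) : perm w (neg P i) = neg P (perm w i) :=
  indexEquiv_neg w.1 i

lemma root_perm (w : P.weylGroup) (i : ι) : P.root (perm w i) = w • P.root i :=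
  (P.weylGroup_apply_root w i).symm

lemma toLinearMap_smul_coroot (w : P.weylGroup) (x : V) (i : ι) :
    P.toLinearMap (w • x) (P.coroot (perm w i)) = P.toLinearMap x (P.coroot i) :=
  toLinearMap_aut_smul_coroot w.1 x i

lemma perm_mul (v w : P.weylGroup) (i : ι) : perm (v * w) i = perm v (perm w i) := by
  simp only [perm, map_mul, Equiv.Perm.mul_apply]

lemma perm_inv (w : P.weylGroup) : perm w⁻¹ = (perm w).symm := by
  simp only [perm, map_inv]; rfl

lemma pairing_perm_perm (w : P.weylGroup) (i j : ι) :
    P.pairing (perm w i) (perm w j) = P.pairing i j := by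
  rw [← P.root_coroot_eq_pairing, root_perm, toLinearMap_smul_coroot, P.root_coroot_eq_pairing]

end Negation

section Positivity

variable {ι V N : Type*} [Fintype ι] [AddCommGroup V] [Module ℝ V] [AddCommGroup N] [Module ℝ N]
  {P : RootPairing ι ℝ V N} [P.IsRootSystem] [P.IsCrystallographic] [P.IsReduced] (b : P.Base)

/-- The height of `α_i^∨`. -/
def coheight (i : ι) : ℝ := P.toLinearMap (rho b) (P.coroot i)

/-- The coefficient of `α_k^∨` in `α_i^∨`. -/
def level (k : b.support) (i : ι) : ℝ := P.toLinearMap (fundamentalWeight b k) (P.coroot i)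


/-- Positivity of roots and of coroots obey the same rules: both hold for simple indices, change
sign under negation, and are kept by a simple reflection except at its own root. Every root is
reached from the simple ones by reflections. -/
lemma isPos_flip_iff (i : ι) : b.flip.IsPos i ↔ b.IsPos i := by
  have : Module.IsReflexive ℝ V := .of_isPerfPair P.toLinearMap
  have : Module.IsReflexive ℝ N := .of_isPerfPair P.flip.toLinearMap
  have hneg : ∀ i, (b.flip.IsPos i ↔ b.IsPos i) →
      (b.flip.IsPos (P.reflectionPerm i i) ↔ b.IsPos (P.reflectionPerm i i)) := by
    intro i hi
    have h1 := isPos_neg_iff b i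
    have h2 := isPos_neg_iff b.flip i
    exact h2.trans ((not_congr hi).trans h1.symm)
  have key : ∀ i j, j ∈ b.support → i ≠ j → b.IsPos i → b.flip.IsPos i →
      (b.flip.IsPos (P.reflectionPerm j i) ↔ b.IsPos (P.reflectionPerm j i)) := by
    intro i j hj hij h1 h2
    exact iff_of_true (h2.reflectionPerm (b := b.flip) hj hij) (h1.reflectionPerm hj hij)
  refine b.induction_reflect i hneg (fun i hi => ?_) (fun i j hi hj => ?_)
  · exact iff_of_true (RootPairing.Base.isPos_of_mem_support (b := b.flip) hi)
      (RootPairing.Base.isPos_of_mem_support hi)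
  · by_cases hij : i = j
    · subst hij; exact hneg i hi
    by_cases h1 : b.IsPos i
    · exact key i j hj hij h1 (hi.2 h1)
    · have h2 : b.IsPos (neg P i) := (isPos_neg_iff b i).2 h1
      have h3 : b.flip.IsPos (neg P i) := (isPos_neg_iff b.flip i).2 (fun h => h1 (hi.1 h))
      by_cases hij' : neg P i = j
      · have : P.reflectionPerm j i = j := by
          rw [← hij']
          apply P.root.injective
          rw [P.root_reflectionPerm, root_neg]
          rw [RootPairing.reflection_apply, root_neg]
          change P.root i - (P.toLinearMap (P.root i) (P.coroot (neg P i))) • -P.root i = _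
          simp only [coroot_neg, map_neg, RootPairing.root_coroot_two]
          module
        rw [this]
        exact iff_of_true (RootPairing.Base.isPos_of_mem_support (b := b.flip) hj)
          (RootPairing.Base.isPos_of_mem_support hj)
      · have h4 := key _ j hj hij' h2 h3
        have h5 : P.reflectionPerm j (neg P i) = neg P (P.reflectionPerm j i) :=
          indexEquiv_neg (RootPairing.Equiv.reflection P j) i
        rw [h5] at h4
        have h6 := isPos_neg_iff b.flip (P.reflectionPerm j i)
        have h7 := isPos_neg_iff b (P.reflectionPerm j i)
        exact not_iff_not.1 (h6.symm.trans (h4.trans h7))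

lemma coweight_eq_sum (y : N) :
    y = ∑ k : b.support, P.toLinearMap (fundamentalWeight b k) y • P.coroot k := by
  conv_lhs => rw [← b.toCoweightBasis.sum_repr y]
  refine Finset.sum_congr rfl fun k _ => ?_
  rw [b.toCoweightBasis_apply, fundamentalWeight, LinearMap.apply_symm_toPerfPair_self,
    Module.Basis.coord_apply]

lemma coroot_eq_sum (i : ι) : P.coroot i = ∑ k : b.support, level b k i • P.coroot k :=
  coweight_eq_sum b _

lemma weight_ext {x y : V} (h : ∀ j : b.support, P.toLinearMap x (P.coroot j) =
    P.toLinearMap y (P.coroot j)) : x = y := by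
  apply P.toLinearMap.toPerfPair.injective
  refine b.toCoweightBasis.ext fun j => ?_
  simpa using h j

open Classical in
lemma level_support (k j : b.support) : level b k j = if j = k then 1 else 0 :=
  fundamentalWeight_pairing b j k

lemma level_neg (k : b.support) (i : ι) : level b k (neg P i) = -level b k i := by
  simp [level]

lemma coheight_neg (i : ι) : coheight b (neg P i) = -coheight b i := by
  simp [coheight]

/-- Levels are coefficients of coroots, so this is the integrality of the dual base; the sign comes
from `isPos_flip_iff`. -/
lemma exists_level_eq_nat {i : ι} (hi : b.IsPos i) :
    ∃ f : b.support → ℕ, ∀ k, level b k i = f k := by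
  classical
  rw [← isPos_flip_iff] at hi
  obtain ⟨f, hf, h | h⟩ := b.flip.exists_root_eq_sum_nat_or_neg i
  · refine ⟨fun k => f k, fun k => ?_⟩
    change P.coroot i = ∑ j ∈ b.support, f j • P.coroot j at h
    rw [level, h, map_sum, ← Finset.sum_coe_sort b.support]
    simp_rw [map_nsmul, fundamentalWeight_pairing]
    simp
  · exfalso
    change P.flip.root i = -∑ j ∈ b.flip.support, f j • P.flip.root j at h
    have h' : P.flip.root i = ∑ j ∈ b.flip.support, (fun j => -(f j : ℤ)) j • P.flip.root j := by
      rw [h]; simp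
    rw [RootPairing.Base.isPos_iff, b.flip.height_eq_sum h'] at hi
    simp only [Finset.sum_neg_distrib] at hi
    have : (0 : ℤ) ≤ ∑ j ∈ b.flip.support, (f j : ℤ) := Finset.sum_nonneg fun _ _ => by positivity
    lia

end Positivity

end

/-! ### Heights and longest elements -/

section

section Heights

variable {ι V N : Type*} [Fintype ι] [AddCommGroup V] [Module ℝ V] [AddCommGroup N] [Module ℝ N]
  {P : RootPairing ι ℝ V N} [P.IsRootSystem] [P.IsCrystallographic] [P.IsReduced] (b : P.Base)

lemma mem_posRoots {i : ι} : i ∈ posRoots b ↔ b.IsPos i := by simp [posRoots]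

lemma mem_inversions {w : P.weylGroup} {i : ι} :
    i ∈ inversions b w ↔ b.IsPos i ∧ ¬ b.IsPos (perm w i) := by
  simp only [inversions, Finset.mem_filter, Finset.mem_univ, true_and]

lemma isPos_reflectionPerm {i j : ι} (hi : b.IsPos i) (hj : j ∈ b.support) (hij : i ≠ j) :
    b.IsPos (P.reflectionPerm j i) := by
  have : Module.IsReflexive ℝ V := .of_isPerfPair P.toLinearMap
  exact hi.reflectionPerm hj hij

lemma sum_pairing_eq_zero (A : Finset ι) (j : ι)
    (hA : ∀ i ∈ A, P.reflectionPerm j i ∈ A) : ∑ i ∈ A, P.pairing i j = 0 := by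
  have h : ∑ i ∈ A, P.pairing i j = ∑ i ∈ A, -P.pairing i j := by
    refine Finset.sum_nbij' (P.reflectionPerm j) (P.reflectionPerm j) hA hA (by simp) (by simp) ?_
    intro i _
    rw [← P.pairing_reflectionPerm, P.pairing_reflectionPerm_self_right, neg_neg]
  rw [Finset.sum_neg_distrib] at h
  linarith

/-- The reflection in α_j permutes `A` without α_j and negates the pairing with α_j^∨, so only half
of ⟨α_j, α_j^∨⟩ = 2 remains. -/
lemma sum_pairing_support (A : Finset ι) (j : b.support) (hj : (j : ι) ∈ A)
    (hpos : ∀ i ∈ A, b.IsPos i) (hA : ∀ i ∈ A, i ≠ j → P.reflectionPerm j i ∈ A) :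
    P.toLinearMap ((2⁻¹ : ℝ) • ∑ i ∈ A, P.root i) (P.coroot j) = 1 := by
  classical
  have h := sum_pairing_eq_zero (P := P) (A.erase j) j (fun i hi => by
    obtain ⟨h1, h2⟩ := Finset.mem_erase.1 hi
    refine Finset.mem_erase.2 ⟨fun h => ?_, hA i h2 h1⟩
    have h3 : i = neg P j := by
      rw [← (P.reflectionPerm j).injective.eq_iff, h]; simp [neg]
    exact (isPos_neg_iff b j).1 (h3 ▸ hpos i h2) (RootPairing.Base.isPos_of_mem_support j.2))
  rw [map_smul, map_sum, LinearMap.smul_apply, LinearMap.sum_apply]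
  simp_rw [P.root_coroot_eq_pairing]
  rw [← Finset.add_sum_erase _ _ hj, h]
  simp

lemma coheight_support (j : b.support) : coheight b j = 1 :=
  sum_pairing_support b _ j ((mem_posRoots b).2 (RootPairing.Base.isPos_of_mem_support j.2))
    (fun _ hi => (mem_posRoots b).1 hi)
    (fun _ hi hij => (mem_posRoots b).2 (isPos_reflectionPerm b ((mem_posRoots b).1 hi) j.2 hij))

lemma toLinearMap_rho (y : N) :
    P.toLinearMap (rho b) y = ∑ k, P.toLinearMap (fundamentalWeight b k) y := by
  conv_lhs => rw [coweight_eq_sum b y]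
  rw [map_sum]
  refine Finset.sum_congr rfl fun k _ => ?_
  rw [map_smul, smul_eq_mul]
  exact (congrArg _ (coheight_support b k)).trans (mul_one _)

lemma coheight_eq_sum (i : ι) : coheight b i = ∑ k, level b k i := toLinearMap_rho b _

/-- Pairing with `α_i^∨` is determined by the pairings with the simple coroots. -/
lemma toLinearMap_coroot_eq_sum (x : V) (i : ι) :
    P.toLinearMap x (P.coroot i) = ∑ k : b.support, level b k i * P.toLinearMap x (P.coroot k) := by
  conv_lhs => rw [coroot_eq_sum b i]
  simp

lemma exists_coheight_eq_nat {i : ι} (hi : b.IsPos i) :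
    ∃ n : ℕ, 1 ≤ n ∧ coheight b i = n := by
  obtain ⟨f, hf⟩ := exists_level_eq_nat b hi
  refine ⟨∑ k, f k, ?_, by rw [coheight_eq_sum]; simp [hf]⟩
  by_contra h
  have h0 : ∀ k, f k = 0 := by
    have : ∑ k, f k = 0 := by lia
    simpa using this
  have : P.coroot i = 0 := by rw [coroot_eq_sum b i]; simp [hf, h0]
  have h2 := P.root_coroot_two i
  rw [this] at h2
  simp at h2

lemma one_le_coheight {i : ι} (hi : b.IsPos i) : 1 ≤ coheight b i := by
  obtain ⟨n, h1, h⟩ := exists_coheight_eq_nat b hi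
  rw [h]; exact_mod_cast h1

lemma coheight_le_neg_one {i : ι} (hi : ¬ b.IsPos i) : coheight b i ≤ -1 := by
  have := one_le_coheight b ((isPos_neg_iff b i).2 hi)
  rw [coheight_neg] at this
  linarith

lemma isPos_iff_coheight {i : ι} : b.IsPos i ↔ 0 < coheight b i := by
  by_cases h : b.IsPos i
  · have := one_le_coheight b h; simp only [h, true_iff]; linarith
  · have := coheight_le_neg_one b h; simp only [h, false_iff]; linarith

lemma exists_coheight_eq_int (i : ι) : ∃ n : ℤ, coheight b i = n := by
  by_cases h : b.IsPos i
  · obtain ⟨n, -, h⟩ := exists_coheight_eq_nat b h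
    exact ⟨n, by simpa using h⟩
  · obtain ⟨n, -, h⟩ := exists_coheight_eq_nat b ((isPos_neg_iff b i).2 h)
    rw [coheight_neg] at h
    exact ⟨-n, by push_cast; linarith⟩

lemma level_nonneg (k : b.support) {i : ι} (hi : b.IsPos i) : 0 ≤ level b k i := by
  obtain ⟨f, hf⟩ := exists_level_eq_nat b hi
  simp [hf]

lemma isPos_of_level_pos (k : b.support) {i : ι} (hi : 0 < level b k i) : b.IsPos i := by
  by_contra h
  have := level_nonneg b k ((isPos_neg_iff b i).2 h)
  rw [level_neg] at this
  linarith

/-- Non-negative integral coefficients with sum 1 leave a single simple coroot. -/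
lemma mem_support_of_coheight {i : ι} (h : coheight b i = 1) : i ∈ b.support := by
  classical
  obtain ⟨f, hf⟩ := exists_level_eq_nat b ((isPos_iff_coheight b).2 (by rw [h]; norm_num))
  rw [coheight_eq_sum] at h
  simp_rw [hf] at h
  norm_cast at h
  have h1 : ∃ k, f k = 1 ∧ ∀ j, j ≠ k → f j = 0 := by
    have : ∃ k, f k ≠ 0 := by by_contra! h0; simp [h0] at h
    obtain ⟨k, hk⟩ := this
    rw [← Finset.add_sum_erase _ _ (Finset.mem_univ k)] at h
    have h2 : ∑ x ∈ Finset.univ.erase k, f x = 0 := by lia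
    refine ⟨k, by lia, fun j hj => ?_⟩
    exact Finset.sum_eq_zero_iff.1 h2 j (by simp [hj])
  obtain ⟨k, hk, hk'⟩ := h1
  have : P.coroot i = P.coroot k := by
    rw [coroot_eq_sum b i, Finset.sum_eq_single k]
    · simp [hf, hk]
    · intro j _ hj; simp [hf, hk' j hj]
    · simp
  rw [P.coroot.injective this]
  exact k.2

/-- Simplicity becomes a condition on the height alone, so whatever preserves heights preserves Δ.
-/
lemma mem_support_iff_coheight {i : ι} : i ∈ b.support ↔ coheight b i = 1 :=
  ⟨fun h => coheight_support b ⟨i, h⟩, mem_support_of_coheight b⟩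

end Heights

/-! ### Elements of maximal length in stabilizers of fundamental weights -/

section Longest

variable {ι V N : Type*} [Fintype ι] [AddCommGroup V] [Module ℝ V] [AddCommGroup N] [Module ℝ N]
  {P : RootPairing ι ℝ V N} [P.IsRootSystem] [P.IsCrystallographic] [P.IsReduced] (b : P.Base)

/-- The reflection in α_j permutes the positive roots other than α_j. It carries Φ_w into the
inversions of the product, which also contain α_j. -/
lemma length_lt_mul_reflection (w : P.weylGroup) (j : b.support) (hj : b.IsPos (perm w j)) :
    length b w < length b (w * RootPairing.weylGroup.ofIdx P j) := by
  classical
  set s := RootPairing.weylGroup.ofIdx P (j : ι)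
  have hs : ∀ i, perm s i = P.reflectionPerm j i := fun i => rfl
  have hss : ∀ i, perm s (perm s i) = i := fun i => by rw [hs, hs]; simp
  have hsj : perm s j = neg P j := rfl
  have hjpos := RootPairing.Base.isPos_of_mem_support (b := b) j.2
  have hsub : insert (j : ι) ((inversions b w).map (perm s).toEmbedding) ⊆
      inversions b (w * s) := by
    intro i hi
    rw [mem_inversions, perm_mul]
    rcases Finset.mem_insert.1 hi with rfl | hi
    · rw [hsj, perm_neg, isPos_neg_iff, not_not]
      exact ⟨hjpos, hj⟩
    · obtain ⟨k, hk, rfl⟩ := Finset.mem_map.1 hi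
      rw [mem_inversions] at hk
      simp only [Equiv.coe_toEmbedding, hss]
      refine ⟨?_, hk.2⟩
      rw [hs]
      refine isPos_reflectionPerm b hk.1 j.2 ?_
      rintro rfl
      exact hk.2 hj
  have hnot : (j : ι) ∉ (inversions b w).map (perm s).toEmbedding := by
    intro h
    obtain ⟨k, hk, hkj⟩ := Finset.mem_map.1 h
    have : k = neg P j := by rw [← hsj, ← hkj]; exact (hss k).symm
    rw [mem_inversions, this, isPos_neg_iff] at hk
    exact hk.1 hjpos
  have := Finset.card_le_card hsub
  rw [Finset.card_insert_of_notMem hnot, Finset.card_map] at this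
  exact this

lemma smul_fundamentalWeight_reflection {j k : b.support} (h : j ≠ k) :
    RootPairing.weylGroup.ofIdx P (j : ι) • fundamentalWeight b k = fundamentalWeight b k := by
  classical
  rw [RootPairing.weylGroup.ofIdx_smul, RootPairing.Equiv.reflection_smul,
    RootPairing.reflection_apply]
  have : P.toLinearMap (fundamentalWeight b k) (P.coroot j) = 0 := by
    rw [fundamentalWeight_pairing, if_neg h]
  change _ - (P.toLinearMap (fundamentalWeight b k) (P.coroot j)) • _ = _
  rw [this, zero_smul, sub_zero]

/-- An element of maximal length in the stabilizer of some fundamental weights makes the other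
simple roots negative. -/
lemma not_isPos_of_maximal (K : Set b.support) (w : P.weylGroup)
    (hw : ∀ k ∈ K, w • fundamentalWeight b k = fundamentalWeight b k)
    (hmax : ∀ v : P.weylGroup, (∀ k ∈ K, v • fundamentalWeight b k = fundamentalWeight b k) →
      length b v ≤ length b w) {j : b.support} (hj : j ∉ K) : ¬ b.IsPos (perm w j) := by
  intro h
  refine absurd (hmax (w * RootPairing.weylGroup.ofIdx P j) fun k hk => ?_)
    (not_le.2 (length_lt_mul_reflection b w j h))
  have hjk : j ≠ k := by rintro rfl; exact hj hk
  rw [mul_smul, smul_fundamentalWeight_reflection b hjk, hw k hk]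

lemma exists_maximal (K : Set b.support) : ∃ w : P.weylGroup,
    (∀ k ∈ K, w • fundamentalWeight b k = fundamentalWeight b k) ∧
    ∀ v : P.weylGroup, (∀ k ∈ K, v • fundamentalWeight b k = fundamentalWeight b k) →
      length b v ≤ length b w := by
  let S : Set ℕ := length b '' {w | ∀ k ∈ K, w • fundamentalWeight b k = fundamentalWeight b k}
  have hne : S.Nonempty := ⟨_, 1, fun k _ => one_smul _ _, rfl⟩
  have hbdd : BddAbove S := ⟨Fintype.card ι, by
    rintro - ⟨w, -, rfl⟩
    exact Finset.card_le_univ _⟩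
  obtain ⟨w, hw, hwS⟩ := Nat.sSup_mem hne hbdd
  exact ⟨w, hw, fun v hv => hwS ▸ le_csSup hbdd ⟨v, hv, rfl⟩⟩

section

variable {b} {K : Set b.support} {w : P.weylGroup}

lemma level_perm_of_fixed {k : b.support} (hw : w • fundamentalWeight b k = fundamentalWeight b k)
    (i : ι) : level b k (perm w i) = level b k i := by
  have := toLinearMap_smul_coroot w (fundamentalWeight b k) i
  rwa [hw] at this

lemma level_perm_symm_of_fixed {k : b.support}
    (hw : w • fundamentalWeight b k = fundamentalWeight b k)
    (i : ι) : level b k ((perm w).symm i) = level b k i := by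
  rw [← level_perm_of_fixed hw, Equiv.apply_symm_apply]

lemma coheight_perm_eq_sum (i : ι) :
    coheight b (perm w i) = ∑ k : b.support, level b k i * coheight b (perm w k) := by
  have h : ∀ i, coheight b (perm w i) = P.toLinearMap (w⁻¹ • rho b) (P.coroot i) := by
    intro i
    rw [coheight, ← toLinearMap_smul_coroot w⁻¹, perm_inv, Equiv.symm_apply_apply]
  simp_rw [h]
  exact toLinearMap_coroot_eq_sum b _ i

variable (hneg : ∀ j : b.support, j ∉ K → ¬ b.IsPos (perm w j))
include hneg

/-- The height of the image is a non-negative combination of the heights of wα_k for k outside `K`,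
all of them at most -1. -/
lemma not_isPos_perm_of_level {i : ι} (hi : b.IsPos i) (hK : ∀ k ∈ K, level b k i = 0) :
    ¬ b.IsPos (perm w i) := by
  rw [isPos_iff_coheight, coheight_perm_eq_sum, not_lt]
  refine Finset.sum_nonpos fun k _ => ?_
  by_cases hk : k ∈ K
  · simp [hK k hk]
  · have := coheight_le_neg_one b (hneg k hk)
    exact mul_nonpos_of_nonneg_of_nonpos (level_nonneg b k hi) (by linarith)

/-- The opposite of a maximal element permutes the simple roots that are not fixed. -/
lemma neg_perm_mem_iff (hw : ∀ k ∈ K, w • fundamentalWeight b k = fundamentalWeight b k) (i : ι) :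
    (∃ h : neg P (perm w i) ∈ b.support, ⟨_, h⟩ ∉ K) ↔ ∃ h : i ∈ b.support, ⟨i, h⟩ ∉ K := by
  classical
  let S : Finset ι := b.support.filter fun i => ∃ h : i ∈ b.support, ⟨i, h⟩ ∉ K
  have hS : ∀ i, i ∈ S ↔ ∃ h : i ∈ b.support, ⟨i, h⟩ ∉ K := by
    intro i; simp only [S, Finset.mem_filter]; grind
  let e : Equiv.Perm ι := (perm w).trans (neg P)
  have he : ∀ i, e.symm i = (perm w).symm (neg P i) := fun _ => rfl
  have hlevel : ∀ k ∈ K, ∀ i, level b k (e.symm i) = -level b k i := fun k hk i => by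
    rw [he, level_perm_symm_of_fixed (hw k hk), level_neg]
  -- By finiteness it is enough that the inverse of `e` maps `S` into itself.
  have hmaps : ∀ j ∈ S, e.symm j ∈ S := by
    intro j hj
    obtain ⟨hj, hjK⟩ := (hS j).1 hj
    have hj0 : ∀ k ∈ K, level b k j = 0 := fun k hk => by
      have := level_support b k ⟨j, hj⟩
      rwa [if_neg (by rintro rfl; exact hjK hk)] at this
    have hi0 : ∀ k ∈ K, level b k (e.symm j) = 0 := fun k hk => by
      rw [hlevel k hk, hj0 k hk, neg_zero]
    have hpj : perm w (e.symm j) = neg P j := by rw [he, Equiv.apply_symm_apply]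
    -- Otherwise the negative of this root is positive of level 0 along `K`, so `w` makes it
    -- negative; but `w` sends it to the positive root `j`.
    have hpos : b.IsPos (e.symm j) := by
      by_contra h
      have h' := not_isPos_perm_of_level hneg ((isPos_neg_iff b _).2 h)
        (fun k hk => by rw [level_neg, hi0 k hk, neg_zero])
      rw [perm_neg, hpj, neg_neg_apply] at h'
      exact h' (RootPairing.Base.isPos_of_mem_support hj)
    have hsum : ∑ k, level b k (e.symm j) ≤ 1 := by
      -- The height 1 of `j` is a sum of levels weighted by numbers that are at least 1 off `K`;
      -- hence the levels add up to at most 1, which forces a simple root.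
      have h1 : (1 : ℝ) = ∑ k : b.support, level b k (e.symm j) * -coheight b (perm w k) := by
        have := coheight_perm_eq_sum (b := b) (w := w) (e.symm j)
        rw [hpj, coheight_neg, (mem_support_iff_coheight b).1 hj] at this
        simp_rw [mul_neg]
        rw [Finset.sum_neg_distrib, ← this, neg_neg]
      rw [h1]
      refine Finset.sum_le_sum fun k _ => ?_
      by_cases hk : k ∈ K
      · simp [hi0 k hk]
      · have := coheight_le_neg_one b (hneg k hk)
        nlinarith [level_nonneg b k hpos]
    rw [← coheight_eq_sum] at hsum
    have hmem : e.symm j ∈ b.support :=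
      mem_support_of_coheight b (le_antisymm hsum (one_le_coheight b hpos))
    refine (hS _).2 ⟨hmem, fun hK => ?_⟩
    have := hi0 _ hK
    have h2 := level_support b ⟨_, hmem⟩ ⟨_, hmem⟩
    rw [if_pos rfl, this] at h2
    norm_num at h2
  have himg : S.map e.symm.toEmbedding = S := by
    refine Finset.eq_of_subset_of_card_le (fun i hi => ?_) (by simp)
    obtain ⟨j, hj, rfl⟩ := Finset.mem_map.1 hi
    exact hmaps j hj
  rw [← hS, ← hS]
  change e i ∈ S ↔ _
  constructor
  · intro h
    simpa using hmaps _ h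
  · intro h
    rw [← himg] at h
    obtain ⟨j, hj, rfl⟩ := Finset.mem_map.1 h
    simpa using hj

end

end Longest

end

/-! ### Levi subgroups and diagram automorphisms -/

section

section FinsetPerm

variable {α : Type*} {A : Finset α} {e : Equiv.Perm α}

lemma map_perm_eq (h : ∀ i ∈ A, e i ∈ A) : A.map e.toEmbedding = A := by
  refine Finset.eq_of_subset_of_card_le (fun i hi => ?_) (by simp)
  obtain ⟨j, hj, rfl⟩ := Finset.mem_map.1 hi
  exact h j hj

lemma sum_perm_eq {M : Type*} [AddCommMonoid M] (h : ∀ i ∈ A, e i ∈ A) (f : α → M) :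
    ∑ i ∈ A, f (e i) = ∑ i ∈ A, f i := by
  conv_rhs => rw [← map_perm_eq h]
  rw [Finset.sum_map]; rfl

end FinsetPerm

variable {ι V N : Type*} [Fintype ι] [AddCommGroup V] [Module ℝ V] [AddCommGroup N] [Module ℝ N]
  {P : RootPairing ι ℝ V N} [P.IsRootSystem] [P.IsCrystallographic] [P.IsReduced] (b : P.Base)

/-- `α_i ∈ Δ_p`. -/
def IsLevi (p : b.support) (i : ι) : Prop := i ∈ b.support ∧ i ≠ p

/-! ### The longest element w_p of the Weyl group of Φ_p -/

section LeviLongest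

variable {b}

lemma level_self (p : b.support) : level b p p = 1 := by
  rw [level_support, if_pos rfl]

lemma IsLevi.level_eq_zero {p : b.support} {i : ι} (h : IsLevi b p i) : level b p i = 0 := by
  have := level_support b p ⟨i, h.1⟩
  rwa [if_neg (fun h' => h.2 (by rw [← h']))] at this

lemma IsLevi.coheight_eq_one {p : b.support} {i : ι} (h : IsLevi b p i) : coheight b i = 1 :=
  (mem_support_iff_coheight b).1 h.1

lemma isLevi_iff {p : b.support} {i : ι} :
    IsLevi b p i ↔ level b p i = 0 ∧ coheight b i = 1 := by
  refine ⟨fun h => ⟨h.level_eq_zero, h.coheight_eq_one⟩, fun ⟨h1, h2⟩ =>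
    ⟨mem_support_of_coheight b h2, ?_⟩⟩
  rintro rfl
  rw [level_self] at h1
  exact one_ne_zero h1

/-- The properties of the longest element `w_p` of the Weyl group of `Φ_p`. -/
structure IsLeviLongest (p : b.support) (v : P.weylGroup) : Prop where
  fixed : v • fundamentalWeight b p = fundamentalWeight b p
  not_isPos : ∀ j : b.support, j ≠ p → ¬ b.IsPos (perm v j)

variable (b) in
lemma exists_isLeviLongest (p : b.support) : ∃ v, IsLeviLongest p v := by
  obtain ⟨v, h1, h2⟩ := exists_maximal b {p}
  exact ⟨v, h1 p rfl, fun j hj => not_isPos_of_maximal b {p} v h1 h2 hj⟩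

namespace IsLeviLongest

variable {p : b.support} {v : P.weylGroup} (hv : IsLeviLongest p v)
include hv

lemma level_perm (i : ι) : level b p (perm v i) = level b p i := level_perm_of_fixed hv.fixed i

lemma not_isPos_perm {i : ι} (hi : b.IsPos i) (h : level b p i = 0) : ¬ b.IsPos (perm v i) :=
  not_isPos_perm_of_level (K := {p}) hv.not_isPos hi (by rintro k rfl; exact h)

/-- `v` preserves levels, and a positive level forces positivity. -/
lemma isPos_perm {i : ι} (hi : b.IsPos i) (h : level b p i ≠ 0) : b.IsPos (perm v i) :=
  isPos_of_level_pos b p (by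
    rw [hv.level_perm]; exact lt_of_le_of_ne (level_nonneg b p hi) h.symm)

lemma isPos_perm_iff {i : ι} (h : level b p i ≠ 0) : b.IsPos (perm v i) ↔ b.IsPos i := by
  refine ⟨fun hi => ?_, fun hi => hv.isPos_perm hi h⟩
  by_contra hn
  have := hv.isPos_perm ((isPos_neg_iff b i).2 hn) (by rwa [level_neg, neg_ne_zero])
  rw [perm_neg, isPos_neg_iff] at this
  exact this hi

lemma isPos_perm_iff_of_level {i : ι} (h : level b p i = 0) :
    b.IsPos (perm v i) ↔ ¬ b.IsPos i := by
  refine ⟨fun hi hi' => hv.not_isPos_perm hi' h hi, fun hi => ?_⟩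
  have := hv.not_isPos_perm ((isPos_neg_iff b i).2 hi) (by rw [level_neg, h, neg_zero])
  rwa [perm_neg, isPos_neg_iff, not_not] at this

lemma isLevi_neg_perm (i : ι) : IsLevi b p (neg P (perm v i)) ↔ IsLevi b p i := by
  have := neg_perm_mem_iff (K := {p}) hv.not_isPos (by rintro k rfl; exact hv.fixed) i
  have h : ∀ i : ι, IsLevi b p i ↔ ∃ h : i ∈ b.support, ⟨i, h⟩ ∉ ({p} : Set b.support) := by
    intro i
    simp [IsLevi, Subtype.ext_iff]
  rw [h, h, this]

/-- `v` permutes the positive roots outside Φ_p and maps Φ_{p+} onto its negative, so only the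
contribution of ρ_p changes sign. -/
lemma smul_rho_eq_sub : v • rho b = rho b - (2 : ℝ) • rhoNormal b p := by
  classical
  have hsmul : v • rho b = (2⁻¹ : ℝ) • ∑ i ∈ posRoots b, P.root (perm v i) := by
    rw [rho, show ∀ x : V, v • ((2⁻¹ : ℝ) • x) = (2⁻¹ : ℝ) • (v • x) from fun x =>
      smul_comm (v : P.Aut) (2⁻¹ : ℝ) x, Finset.smul_sum]
    simp_rw [root_perm]
  have hN : ∀ i, i ∈ (posRoots b).filter (fun i => level b p i = 0) ↔ i ∈ posRootsNormal b p := by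
    intro i; rw [Finset.mem_filter, posRootsNormal, Finset.mem_filter]; rfl
  have h1 : ∑ i ∈ posRoots b with level b p i = 0, P.root (perm v i) =
      -∑ i ∈ posRootsNormal b p, P.root i := by
    have := sum_perm_eq (A := (posRoots b).filter (fun i => level b p i = 0))
      (e := (perm v).trans (neg P)) (fun i hi => by
        simp only [Finset.mem_filter, mem_posRoots, Equiv.trans_apply] at hi ⊢
        rw [isPos_neg_iff, level_neg, hv.level_perm, hi.2]
        exact ⟨hv.not_isPos_perm hi.1 hi.2, neg_zero⟩) P.root
    simp only [Equiv.trans_apply, root_neg, Finset.sum_neg_distrib] at this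
    rw [← neg_eq_iff_eq_neg, this]
    exact Finset.sum_congr (Finset.ext hN) fun _ _ => rfl
  have h2 : ∑ i ∈ posRoots b with ¬ level b p i = 0, P.root (perm v i) =
      ∑ i ∈ posRoots b with ¬ level b p i = 0, P.root i :=
    sum_perm_eq (A := (posRoots b).filter (fun i => ¬ level b p i = 0))
      (e := perm v) (fun i hi => by
        simp only [Finset.mem_filter, mem_posRoots] at hi ⊢
        rw [hv.level_perm]
        exact ⟨hv.isPos_perm hi.1 hi.2, hi.2⟩) P.root
  rw [hsmul, rho, rhoNormal, ← Finset.sum_filter_add_sum_filter_not (posRoots b)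
    (fun i => level b p i = 0) P.root, ← Finset.sum_filter_add_sum_filter_not (posRoots b)
    (fun i => level b p i = 0), h1, h2, Finset.sum_congr (Finset.ext hN) fun _ _ => rfl]
  module

lemma toLinearMap_smul_rho (i : ι) :
    P.toLinearMap (v • rho b) (P.coroot (perm v i)) = coheight b i :=
  toLinearMap_smul_coroot v _ i

/-- This is the source of s ↦ -c_p - s. Against α_p^∨ it is the definition of c_p; against another
simple coroot, -v permutes Δ_p, so the pairing with vρ is -1. -/
lemma smul_rho : v • rho b = center b p • fundamentalWeight b p - rho b := by
  refine weight_ext b fun j => ?_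
  rw [map_sub, LinearMap.sub_apply, LinearMap.map_smul, LinearMap.smul_apply]
  change _ = _ • level b p j - coheight b j
  rw [coheight_support]
  by_cases hj : j = p
  · subst hj
    have h2 : P.toLinearMap (rho b) (P.coroot j) = 1 := coheight_support b j
    have h3 : P.toLinearMap (fundamentalWeight b j) (P.coroot j) = 1 := level_self j
    rw [level_self, hv.smul_rho_eq_sub, center]
    simp only [map_sub, map_smul, LinearMap.sub_apply, LinearMap.smul_apply, smul_eq_mul, h2, h3]
    ring
  · have hl : IsLevi b p j := ⟨j.2, fun h => hj (Subtype.ext h)⟩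
    obtain ⟨i, hi⟩ := ((perm v).trans (neg P)).surjective j
    simp only [Equiv.trans_apply] at hi
    have hli : IsLevi b p i := by rw [← hv.isLevi_neg_perm, hi]; exact hl
    rw [hl.level_eq_zero, ← hi, coroot_neg, map_neg, hv.toLinearMap_smul_rho, hli.coheight_eq_one]
    simp

lemma coheight_perm (i : ι) :
    coheight b (perm v i) = center b p * level b p i - coheight b i := by
  have h := hv.toLinearMap_smul_rho i
  rw [hv.smul_rho, map_sub, LinearMap.sub_apply, map_smul, LinearMap.smul_apply] at h
  change _ • level b p (perm v i) - coheight b (perm v i) = _ at h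
  rw [hv.level_perm, smul_eq_mul] at h
  linarith

end IsLeviLongest

end LeviLongest

/-! ### Diagram automorphisms as automorphisms of the root system -/

section DiagramAut

variable {b}

lemma autV_root (ϖ : Equiv.Perm b.support) (j : b.support) :
    autV b ϖ (P.root j) = P.root (ϖ j) := by
  rw [autV, ← b.toWeightBasis_apply, Module.Basis.equiv_apply, b.toWeightBasis_apply]

lemma autN_simple_coroot (ϖ : Equiv.Perm b.support) (j : b.support) :
    autN b ϖ (P.coroot j) = P.coroot (ϖ j) := by
  rw [autN, ← b.toCoweightBasis_apply, Module.Basis.equiv_apply, b.toCoweightBasis_apply]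

/-- The properties of the automorphism `g` of the root system extending a diagram automorphism. -/
structure Extends (g : P.Aut) (ϖ : Equiv.Perm b.support) : Prop where
  smul : ∀ x : V, g • x = autV b ϖ x
  coweightMap : ∀ y : N, g.coweightMap (autN b ϖ y) = y

lemma IsDiagramAut.exists_extends {ϖ : Equiv.Perm b.support} (h : IsDiagramAut b ϖ) :
    ∃ g : P.Aut, Extends g ϖ := by
  have : Module.IsReflexive ℝ V := .of_isPerfPair P.toLinearMap
  have : Module.IsReflexive ℝ N := .of_isPerfPair P.flip.toLinearMap
  let g : P.Aut := b.equivOfCartanMatrixEq b ϖ h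
  have hg : ∀ x : V, g • x = autV b ϖ x := fun x => rfl
  refine ⟨g, hg, fun y => ?_⟩
  have hidx : ∀ j : b.support, g.indexEquiv j = ϖ j := fun j => P.root.injective <| by
    rw [root_indexEquiv, hg, autV_root]
  have : g.coweightMap ∘ₗ (autN b ϖ).toLinearMap = LinearMap.id := by
    -- The transpose of `g` undoes the permutation of the simple coroots, which form a basis.
    refine b.toCoweightBasis.ext fun j => ?_
    simp only [LinearMap.comp_apply, LinearEquiv.coe_coe, LinearMap.id_apply,
      RootPairing.Base.toCoweightBasis_apply]
    rw [autN_simple_coroot, ← hidx, RootPairing.Hom.coroot_coweightMap_apply, Equiv.symm_apply_apply]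
  exact LinearMap.congr_fun this y

namespace Extends

variable {g : P.Aut} {ϖ : Equiv.Perm b.support} (hg : Extends g ϖ)
include hg

lemma indexEquiv (j : b.support) : g.indexEquiv j = ϖ j := P.root.injective <| by
  rw [root_indexEquiv, hg.smul, autV_root]

lemma toLinearMap_smul (x : V) (y : N) :
    P.toLinearMap (g • x) (autN b ϖ y) = P.toLinearMap x y := by
  rw [toLinearMap_aut_smul, hg.coweightMap]

lemma autN_coroot (i : ι) : autN b ϖ (P.coroot i) = P.coroot (g.indexEquiv i) := by
  have h : P.coroot i = g.coweightMap (P.coroot (g.indexEquiv i)) := by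
    rw [RootPairing.Hom.coroot_coweightMap_apply, Equiv.symm_apply_apply]
  apply g.bijective_coweightMap.injective
  rw [hg.coweightMap, h]

lemma smul_fundamentalWeight (k : b.support) :
    g • fundamentalWeight b k = fundamentalWeight b (ϖ k) := by
  classical
  refine weight_ext b fun j => ?_
  obtain ⟨j, rfl⟩ := ϖ.surjective j
  rw [← hg.indexEquiv, toLinearMap_aut_smul_coroot, hg.indexEquiv, fundamentalWeight_pairing,
    fundamentalWeight_pairing]
  simp

lemma level_indexEquiv (k : b.support) (i : ι) :
    level b (ϖ k) (g.indexEquiv i) = level b k i := by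
  rw [level, ← hg.smul_fundamentalWeight, toLinearMap_aut_smul_coroot, level]

lemma coheight_indexEquiv (i : ι) : coheight b (g.indexEquiv i) = coheight b i := by
  rw [coheight_eq_sum, coheight_eq_sum, ← Equiv.sum_comp ϖ]
  simp_rw [hg.level_indexEquiv]

lemma isPos_indexEquiv (i : ι) : b.IsPos (g.indexEquiv i) ↔ b.IsPos i := by
  rw [isPos_iff_coheight, isPos_iff_coheight, hg.coheight_indexEquiv]

lemma mem_support_indexEquiv (i : ι) : g.indexEquiv i ∈ b.support ↔ i ∈ b.support := by
  rw [mem_support_iff_coheight, mem_support_iff_coheight, hg.coheight_indexEquiv]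

lemma isLevi_indexEquiv (p : b.support) (i : ι) :
    IsLevi b (ϖ p) (g.indexEquiv i) ↔ IsLevi b p i := by
  rw [isLevi_iff, isLevi_iff, hg.coheight_indexEquiv, hg.level_indexEquiv]

lemma smul_rho : g • rho b = rho b := by
  refine weight_ext b fun j => ?_
  obtain ⟨j, rfl⟩ := ϖ.surjective j
  rw [← hg.indexEquiv, toLinearMap_aut_smul_coroot]
  exact (hg.coheight_indexEquiv j).symm

end Extends

end DiagramAut

/-! ### The opposition automorphism ϖ₀ = -w₀⁻¹ -/

section Opposition

variable {b}

lemma IsLongest.not_isPos {w₀ : P.weylGroup} (h : IsLongest b w₀) {i : ι} (hi : b.IsPos i) :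
    ¬ b.IsPos (perm w₀ i) :=
  not_isPos_perm_of_level (K := ∅)
    (fun j _ => not_isPos_of_maximal b ∅ w₀ (by simp) (fun v _ => h v) (by simp)) hi (by simp)

lemma IsLongest.not_isPos_inv {w₀ : P.weylGroup} (h : IsLongest b w₀) {i : ι} (hi : b.IsPos i) :
    ¬ b.IsPos (perm w₀⁻¹ i) := by
  intro h'
  have := h.not_isPos h'
  rw [perm_inv, Equiv.apply_symm_apply] at this
  exact this hi

/-- The diagram automorphism `ϖ₀` with `-1 = ϖ₀ w₀`. -/
lemma IsLongest.exists_diagramAut {w₀ : P.weylGroup} (h : IsLongest b w₀) :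
    ∃ ϖ₀ : Equiv.Perm b.support, IsDiagramAut b ϖ₀ ∧ ∀ x : V, autV b ϖ₀ x = -(w₀⁻¹ • x) := by
  -- Solving -1 = ϖ₀ w₀ for ϖ₀ gives -w₀⁻¹; with the inverse kept, w₀² = 1 is not needed.
  let e : Equiv.Perm ι := (perm w₀⁻¹).trans (neg P)
  have he : ∀ i, e i ∈ b.support ↔ i ∈ b.support := fun i => by
    have := neg_perm_mem_iff (b := b) (K := ∅) (w := w₀⁻¹)
      (fun j _ => h.not_isPos_inv (RootPairing.Base.isPos_of_mem_support j.2)) (by simp) i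
    simp only [Set.mem_empty_iff_false, not_false_eq_true, exists_prop, and_true] at this
    exact this
  let ϖ₀ : Equiv.Perm b.support := e.subtypePerm he
  have hϖ : ∀ j : b.support, ((ϖ₀ j : b.support) : ι) = neg P (perm w₀⁻¹ j) := fun j => rfl
  refine ⟨ϖ₀, fun i j => ?_, fun x => ?_⟩
  · apply FaithfulSMul.algebraMap_injective ℤ ℝ
    rw [RootPairing.Base.algebraMap_cartanMatrixIn_apply,
      RootPairing.Base.algebraMap_cartanMatrixIn_apply, hϖ, hϖ, pairing_neg_neg,
      pairing_perm_perm]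
  · have : (autV b ϖ₀).toLinearMap = -(P.weylGroupRootRep w₀⁻¹) := by
      refine b.toWeightBasis.ext fun j => ?_
      rw [LinearEquiv.coe_coe, RootPairing.Base.toWeightBasis_apply, autV_root, hϖ, root_neg,
        root_perm]
      rfl
    exact LinearMap.congr_fun this x

end Opposition

end

/-! ### The closed form of the iterated residue and its opposite terms -/

section

variable {ι V N : Type*} [Fintype ι] [AddCommGroup V] [Module ℝ V] [AddCommGroup N] [Module ℝ N]
  {P : RootPairing ι ℝ V N} [P.IsRootSystem] [P.IsCrystallographic] [P.IsReduced] (b : P.Base)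

/-- `⟨λ, α_i^∨⟩` at `λ = ρ + s λ_p`. -/
def arg (p : b.support) (i : ι) (s : ℂ) : ℂ := (level b p i : ℂ) * s + coheight b i

/-- `⟨wλ - ρ, y⟩` at `λ = ρ + s λ_p`. -/
def exponent (p : b.support) (w : P.weylGroup) (y : N) (s : ℂ) : ℂ :=
  (P.toLinearMap (w • rho b - rho b) y : ℝ) +
    (P.toLinearMap (w • fundamentalWeight b p) y : ℝ) * s

open Classical in
/-- The product of values of `ξ` in the term of `w`. -/
def xiRatio (p : b.support) (w : P.weylGroup) (s : ℂ) : ℂ :=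
  (∏ i ∈ inversions b w with ¬ IsLevi b p i, xi (arg b p i s)) /
    ∏ i ∈ inversions b w, xi (arg b p i s + 1)

open Classical in
/-- The residue of the term of `w`, if `w` survives. -/
def term (p : b.support) (T : N) (s : ℂ) (w : P.weylGroup) : ℂ :=
  Complex.exp (exponent b p w T s) *
    (∏ i ∈ b.support with ¬ IsLevi b p ((perm w).symm i), 1 / exponent b p w (P.coroot i) s) *
    xiRatio b p w s

open Classical in
/-- The closed form of the iterated residue. -/
def residueSum (p : b.support) (T : N) (s : ℂ) : ℂ :=
  ∑ᶠ w : P.weylGroup, if Survives b p w then term b p T s w else 0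

open Classical in
/-- The number of roots in `A` with given level and height. -/
def count (p : b.support) (A : Finset ι) (k h : ℝ) : ℕ :=
  (A.filter fun i => level b p i = k ∧ coheight b i = h).card

/-- `minimalExponent` with real arguments, at positive levels. -/
def exponentAt (p : b.support) (k h : ℝ) : ℕ :=
  sInf {m : ℕ | ∀ w : P.weylGroup, Survives b p w →
    count b p (inversions b w) k (h - 1) ≤ m + count b p (inversions b w) k h}

variable {b}

lemma survives_iff {p : b.support} {w : P.weylGroup} : Survives b p w ↔
    ∀ i, IsLevi b p i → (perm w i ∈ b.support ∨ ¬ b.IsPos (perm w i)) :=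
  ⟨fun h i hi => h ⟨i, hi.1⟩ (fun h' => hi.2 (congrArg Subtype.val h')),
    fun h j hj => h j ⟨j.2, fun h' => hj (Subtype.ext h')⟩⟩

lemma weylGroup_smul_smul (w : P.weylGroup) (c : ℝ) (x : V) : w • (c • x) = c • (w • x) :=
  smul_comm (w : P.Aut) c x

lemma aut_smul_smul (g : P.Aut) (c : ℝ) (x : V) : g • (c • x) = c • (g • x) :=
  smul_comm g c x

lemma inversions_one : inversions b 1 = ∅ := by
  ext i; rw [mem_inversions]; simp [perm]

lemma survives_one (p : b.support) : Survives b p 1 := by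
  intro j _
  left
  simp [perm]

/-- The roots span V, so an element is determined by its permutation of them. Finiteness keeps the
`finsum` over the group from taking its default value 0. -/
lemma finite_weylGroup (b : P.Base) : Finite P.weylGroup := by
  refine Finite.of_injective (perm (P := P)) fun w w' hww' => ?_
  apply Subtype.ext
  apply RootPairing.Equiv.weightHom_injective P
  apply LinearEquiv.toLinearMap_injective
  refine b.toWeightBasis.ext fun j => ?_
  rw [b.toWeightBasis_apply]
  change w • P.root j = w' • P.root j
  rw [← root_perm, ← root_perm, hww']

/-! ### The symmetry w ↦ u w v of the terms -/

section Opposite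

/-- The data for the symmetry `w ↦ u w v`. -/
structure IsOpposition (p : b.support) (u v : P.weylGroup) (g : P.Aut)
    (ϖ : Equiv.Perm b.support) : Prop where
  levi : IsLeviLongest p v
  ext : Extends g ϖ
  smul : ∀ x : V, u • x = -(g • x)

namespace IsOpposition

variable {p : b.support} {u v w : P.weylGroup} {g : P.Aut} {ϖ : Equiv.Perm b.support}
  (h : IsOpposition p u v g ϖ)
include h

/-- Since u = -g, the product acts as g w (-v): here -v permutes Δ_p and `g` preserves Δ and the
sign of every root. -/
lemma perm_apply (i : ι) : perm (u * w * v) i = g.indexEquiv (perm w (neg P (perm v i))) := by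
  have hu : ∀ i, perm u i = neg P (g.indexEquiv i) := fun i => P.root.injective <| by
    rw [root_perm, h.smul, root_neg, root_indexEquiv]
  rw [perm_mul, perm_mul, hu, perm_neg, indexEquiv_neg]

lemma isPos_perm (i : ι) : b.IsPos (perm (u * w * v) i) ↔ ¬ b.IsPos (perm w (perm v i)) := by
  rw [h.perm_apply, h.ext.isPos_indexEquiv, perm_neg, isPos_neg_iff]

lemma survives : Survives b p (u * w * v) ↔ Survives b p w := by
  rw [survives_iff, survives_iff]
  have hiff : ∀ i, (perm (u * w * v) i ∈ b.support ∨ ¬ b.IsPos (perm (u * w * v) i)) ↔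
      (perm w (neg P (perm v i)) ∈ b.support ∨ ¬ b.IsPos (perm w (neg P (perm v i)))) := by
    intro i
    rw [h.perm_apply, h.ext.isPos_indexEquiv, h.ext.mem_support_indexEquiv]
  simp_rw [hiff]
  constructor
  · intro H i hi
    obtain ⟨j, rfl⟩ := ((perm v).trans (neg P)).surjective i
    exact H j ((h.levi.isLevi_neg_perm j).1 hi)
  · intro H i hi
    exact H _ ((h.levi.isLevi_neg_perm i).2 hi)

/-- With t = -c_p - s one has v(ρ + t λ_p) = -(ρ + s λ_p). Applying uw = -gw gives g w(ρ + s λ_p),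
and `g` fixes ρ. -/
lemma exponent_eq (y : N) (s : ℂ) :
    exponent b p (u * w * v) (autN b ϖ y) (-(center b p : ℂ) - s) = exponent b p w y s := by
  have h1 : (u * w * v) • fundamentalWeight b p = -(g • (w • fundamentalWeight b p)) := by
    rw [mul_smul, h.levi.fixed, mul_smul, h.smul]
  have h2 : (u * w * v) • rho b - rho b =
      g • ((w • rho b - rho b) - center b p • (w • fundamentalWeight b p)) := by
    rw [mul_smul, h.levi.smul_rho, mul_smul, smul_sub, weylGroup_smul_smul, h.smul]
    have hrho : ∀ x : V, -(g • x) - rho b = g • (-x - rho b) := fun x => by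
      rw [smul_sub, smul_neg, h.ext.smul_rho]
    rw [hrho]
    congr 1
    abel
  have h3 : P.toLinearMap (-(g • (w • fundamentalWeight b p))) (autN b ϖ y) =
      -P.toLinearMap (w • fundamentalWeight b p) y := by
    rw [map_neg, LinearMap.neg_apply, h.ext.toLinearMap_smul]
  have h4 : P.toLinearMap ((w • rho b - rho b) - center b p • (w • fundamentalWeight b p)) y =
      P.toLinearMap (w • rho b - rho b) y - center b p *
        P.toLinearMap (w • fundamentalWeight b p) y := by
    rw [map_sub, LinearMap.sub_apply, LinearMap.map_smul, LinearMap.smul_apply, smul_eq_mul]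
  rw [exponent, exponent, h1, h2, h.ext.toLinearMap_smul, h3, h4]
  push_cast
  ring

/-- At level 0 the argument is the height, which -v preserves there. -/
lemma arg_of_level_eq_zero {i : ι} (hi : level b p i = 0) (s t : ℂ) :
    arg b p (neg P (perm v i)) s = arg b p i t := by
  simp only [arg, level_neg, h.levi.level_perm, hi, coheight_neg, h.levi.coheight_perm]
  push_cast
  ring

lemma arg_perm (i : ι) (s : ℂ) : arg b p i (-(center b p : ℂ) - s) = -arg b p (perm v i) s := by
  simp only [arg, h.levi.level_perm, h.levi.coheight_perm]
  push_cast
  ring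

open Classical in
lemma prod_support_eq (s : ℂ) :
    ∏ i ∈ b.support with ¬ IsLevi b p ((perm (u * w * v)).symm i),
      1 / exponent b p (u * w * v) (P.coroot i) (-(center b p : ℂ) - s) =
    ∏ i ∈ b.support with ¬ IsLevi b p ((perm w).symm i), 1 / exponent b p w (P.coroot i) s := by
  symm
  refine Finset.prod_equiv g.indexEquiv (fun i => ?_) (fun i _ => ?_)
  · simp only [Finset.mem_filter]
    rw [h.ext.mem_support_indexEquiv]
    obtain ⟨j, rfl⟩ := ((perm v).trans ((neg P).trans (perm w))).surjective i
    simp only [Equiv.trans_apply]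
    rw [← h.perm_apply, Equiv.symm_apply_apply, Equiv.symm_apply_apply, h.levi.isLevi_neg_perm]
  · rw [← h.ext.autN_coroot, h.exponent_eq]

open Classical in
-- -v permutes Φ_{p+}, so at level 0 it matches the two inversion sets.
lemma mem_inversions_level_zero {i : ι} : (i ∈ inversions b (u * w * v) ∧ level b p i = 0) ↔
    neg P (perm v i) ∈ inversions b w ∧ level b p (neg P (perm v i)) = 0 := by
  rw [mem_inversions, mem_inversions, level_neg, h.levi.level_perm, neg_eq_zero, h.isPos_perm,
    perm_neg, isPos_neg_iff, isPos_neg_iff]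
  constructor
  · rintro ⟨⟨h1, h2⟩, h3⟩
    exact ⟨⟨h.levi.not_isPos_perm h1 h3, h2⟩, h3⟩
  · rintro ⟨⟨h1, h2⟩, h3⟩
    refine ⟨⟨?_, h2⟩, h3⟩
    rwa [h.levi.isPos_perm_iff_of_level h3, not_not] at h1

open Classical in
-- Off Φ_p, `v` preserves signs while `u` reverses them, so inversions turn into non-inversions.
lemma mem_inversions_level_ne_zero {i : ι} :
    (i ∈ inversions b (u * w * v) ∧ level b p i ≠ 0) ↔
      perm v i ∈ posRoots b \ inversions b w ∧ level b p (perm v i) ≠ 0 := by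
  rw [Finset.mem_sdiff, mem_posRoots, mem_inversions, mem_inversions, h.levi.level_perm,
    h.isPos_perm]
  constructor
  · rintro ⟨⟨h1, h2⟩, h3⟩
    exact ⟨⟨h.levi.isPos_perm h1 h3, fun h4 => h4.2 (not_not.1 h2)⟩, h3⟩
  · rintro ⟨⟨h1, h2⟩, h3⟩
    exact ⟨⟨(h.levi.isPos_perm_iff h3).1 h1, fun h4 => h2 ⟨h1, h4⟩⟩, h3⟩

omit h in
open Classical in
-- Δ_p lies at level 0, so the omission of its numerators concerns only the first factor.
lemma _root_.Weng.xiRatio_eq_mul (p : b.support) (w : P.weylGroup) (s : ℂ) : xiRatio b p w s =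
    ((∏ i ∈ inversions b w with level b p i = 0, if IsLevi b p i then 1 else xi (arg b p i s)) /
      ∏ i ∈ inversions b w with level b p i = 0, xi (arg b p i s + 1)) *
    ∏ i ∈ inversions b w with level b p i ≠ 0, xi (arg b p i s) / xi (arg b p i s + 1) := by
  rw [xiRatio, Finset.prod_filter, ← Finset.prod_filter_mul_prod_filter_not (inversions b w)
    (fun i => level b p i = 0), ← Finset.prod_filter_mul_prod_filter_not (inversions b w)
    (fun i => level b p i = 0) (fun i => xi (arg b p i s + 1)), mul_div_mul_comm,
    Finset.prod_div_distrib]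
  congr 2
  · exact Finset.prod_congr rfl fun i _ => by simp only [ite_not]
  · refine Finset.prod_congr rfl fun i hi => ?_
    rw [if_pos]
    exact fun h => (Finset.mem_filter.1 hi).2 h.level_eq_zero

open Classical in
-- The factors of level 0 agree. At other levels the functional equation of ξ inverts each quotient
-- and the index set becomes the complement of Φ_w; together with Φ_w it fills Φ₊, so the correcting
-- products do not depend on `w`.
lemma xiRatio_mul_prod (s : ℂ) (hs : ∀ i ∈ posRoots b, level b p i ≠ 0 →
      xi (arg b p i s) ≠ 0 ∧ xi (arg b p i s + 1) ≠ 0) :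
    xiRatio b p (u * w * v) (-(center b p : ℂ) - s) *
      ∏ i ∈ posRoots b with level b p i ≠ 0, xi (arg b p i s) =
    xiRatio b p w s * ∏ i ∈ posRoots b with level b p i ≠ 0, xi (arg b p i s + 1) := by
  set t := -(center b p : ℂ) - s
  have e0 : ∀ i, i ∈ (inversions b (u * w * v)).filter (fun i => level b p i = 0) ↔
      ((perm v).trans (neg P)) i ∈ (inversions b w).filter (fun i => level b p i = 0) := by
    intro i
    rw [Finset.mem_filter, Finset.mem_filter]
    exact h.mem_inversions_level_zero
  have hA : ∏ i ∈ inversions b (u * w * v) with level b p i = 0,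
        (if IsLevi b p i then 1 else xi (arg b p i t)) =
      ∏ i ∈ inversions b w with level b p i = 0, if IsLevi b p i then 1 else xi (arg b p i s) := by
    refine Finset.prod_equiv _ e0 fun i hi => ?_
    simp only [Equiv.trans_apply]
    rw [h.arg_of_level_eq_zero (Finset.mem_filter.1 hi).2 s t]
    simp only [h.levi.isLevi_neg_perm]
  have hB : ∏ i ∈ inversions b (u * w * v) with level b p i = 0, xi (arg b p i t + 1) =
      ∏ i ∈ inversions b w with level b p i = 0, xi (arg b p i s + 1) := by
    refine Finset.prod_equiv _ e0 fun i hi => ?_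
    simp only [Equiv.trans_apply]
    rw [h.arg_of_level_eq_zero (Finset.mem_filter.1 hi).2 s t]
  have hC : ∏ i ∈ inversions b (u * w * v) with level b p i ≠ 0,
        xi (arg b p i t) / xi (arg b p i t + 1) =
      ∏ i ∈ posRoots b \ inversions b w with level b p i ≠ 0,
        xi (arg b p i s + 1) / xi (arg b p i s) := by
    refine Finset.prod_equiv (perm v) (fun i => ?_) fun i _ => ?_
    · rw [Finset.mem_filter, Finset.mem_filter]
      exact h.mem_inversions_level_ne_zero
    -- With a the argument at `perm v i`: ξ(-a) = ξ(a + 1) and ξ(1 - a) = ξ(a).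
    · rw [h.arg_perm, xi, xi, ← completedRiemannZeta_one_sub,
        ← completedRiemannZeta_one_sub (-arg b p (perm v i) s + 1)]
      congr 2 <;> ring
  have hsub : inversions b w ⊆ posRoots b := fun i hi =>
    (mem_posRoots b).2 ((mem_inversions b).1 hi).1
  have hsplit : ∀ f : ι → ℂ, ∏ i ∈ posRoots b with level b p i ≠ 0, f i =
      (∏ i ∈ posRoots b \ inversions b w with level b p i ≠ 0, f i) *
        ∏ i ∈ inversions b w with level b p i ≠ 0, f i := fun f => by
    rw [Finset.prod_filter, Finset.prod_filter, Finset.prod_filter, Finset.prod_sdiff hsub]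
  have hne : ∀ A ⊆ posRoots b, ∏ i ∈ A with level b p i ≠ 0, xi (arg b p i s) ≠ 0 ∧
      ∏ i ∈ A with level b p i ≠ 0, xi (arg b p i s + 1) ≠ 0 := fun A hA =>
    ⟨Finset.prod_ne_zero_iff.2 fun i hi =>
      (hs i (hA (Finset.mem_filter.1 hi).1) (Finset.mem_filter.1 hi).2).1,
    Finset.prod_ne_zero_iff.2 fun i hi =>
      (hs i (hA (Finset.mem_filter.1 hi).1) (Finset.mem_filter.1 hi).2).2⟩
  rw [xiRatio_eq_mul, xiRatio_eq_mul, hA, hB, hC, hsplit, hsplit, Finset.prod_div_distrib,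
    Finset.prod_div_distrib]
  obtain ⟨h1, h2⟩ := hne _ hsub
  obtain ⟨h3, h4⟩ := hne _ (Finset.sdiff_subset (s := posRoots b) (t := inversions b w))
  field_simp

open Classical in
lemma term_mul_prod (T : N) (s : ℂ) (hs : ∀ i ∈ posRoots b, level b p i ≠ 0 →
      xi (arg b p i s) ≠ 0 ∧ xi (arg b p i s + 1) ≠ 0) :
    term b p (autN b ϖ T) (-(center b p : ℂ) - s) (u * w * v) *
      ∏ i ∈ posRoots b with level b p i ≠ 0, xi (arg b p i s) =
    term b p T s w * ∏ i ∈ posRoots b with level b p i ≠ 0, xi (arg b p i s + 1) := by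
  rw [term, term, h.exponent_eq, h.prod_support_eq, mul_assoc, mul_assoc (_ * _),
    h.xiRatio_mul_prod s hs]

open Classical in
lemma residueSum_mul_prod (T : N) (s : ℂ) (hs : ∀ i ∈ posRoots b, level b p i ≠ 0 →
      xi (arg b p i s) ≠ 0 ∧ xi (arg b p i s + 1) ≠ 0) :
    residueSum b p (autN b ϖ T) (-(center b p : ℂ) - s) *
      ∏ i ∈ posRoots b with level b p i ≠ 0, xi (arg b p i s) =
    residueSum b p T s * ∏ i ∈ posRoots b with level b p i ≠ 0, xi (arg b p i s + 1) := by
  have := finite_weylGroup b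
  rw [residueSum, residueSum, finsum_mul', finsum_mul',
    ← finsum_comp_equiv ((Equiv.mulLeft u).trans (Equiv.mulRight v))]
  · refine finsum_congr fun w => ?_
    simp only [Equiv.trans_apply, Equiv.coe_mulLeft, Equiv.coe_mulRight, h.survives]
    split_ifs
    · exact h.term_mul_prod T s hs
    · simp
  all_goals exact Set.toFinite _

end IsOpposition

end Opposite

end

/-! ### Exponents of opposite terms -/

section

variable {ι V N : Type*} [Fintype ι] [AddCommGroup V] [Module ℝ V] [AddCommGroup N] [Module ℝ N]
  {P : RootPairing ι ℝ V N} [P.IsRootSystem] [P.IsCrystallographic] [P.IsReduced] {b : P.Base}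

section Exponents

lemma count_mono {p : b.support} {A B : Finset ι} (h : A ⊆ B) (k l : ℝ) :
    count b p A k l ≤ count b p B k l :=
  Finset.card_le_card (Finset.filter_subset_filter _ h)

lemma count_empty (p : b.support) (k l : ℝ) : count b p ∅ k l = 0 := by simp [count]

lemma inversions_subset (w : P.weylGroup) : inversions b w ⊆ posRoots b := fun _ hi =>
  (mem_posRoots b).2 ((mem_inversions b).1 hi).1

lemma exponentAt_spec (p : b.support) (k l : ℝ) {w : P.weylGroup} (hw : Survives b p w) :
    count b p (inversions b w) k (l - 1) ≤
      exponentAt b p k l + count b p (inversions b w) k l := by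
  -- Non-emptiness is what makes `sInf` an attained minimum; the number of all positive roots of
  -- that level and height is admissible.
  have hne : {m : ℕ | ∀ w : P.weylGroup, Survives b p w →
      count b p (inversions b w) k (l - 1) ≤ m + count b p (inversions b w) k l}.Nonempty :=
    ⟨count b p (posRoots b) k (l - 1), fun w _ =>
      (count_mono (inversions_subset w) _ _).trans (Nat.le_add_right _ _)⟩
  exact Nat.sInf_mem hne w hw

lemma exponentAt_le {p : b.support} {k l : ℝ} {m : ℕ} (h : ∀ w : P.weylGroup, Survives b p w →
      count b p (inversions b w) k (l - 1) ≤ m + count b p (inversions b w) k l) :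
    exponentAt b p k l ≤ m := Nat.sInf_le h

lemma exponentAt_eq_zero {p : b.support} {k l : ℝ} (h : count b p (posRoots b) k (l - 1) = 0) :
    exponentAt b p k l = 0 := Nat.le_zero.1 <| exponentAt_le fun w _ =>
  ((count_mono (inversions_subset w) _ _).trans h.le).trans (Nat.zero_le _)

lemma count_eq_zero_of_lt_one {p : b.support} {k l : ℝ} (hl : l < 1) :
    count b p (posRoots b) k l = 0 := by
  rw [count, Finset.card_eq_zero, Finset.filter_eq_empty_iff]
  rintro i hi ⟨-, rfl⟩
  exact absurd (one_le_coheight b ((mem_posRoots b).1 hi)) (not_le.2 hl)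

/-- Roots of Δ_p have level 0, so excluding them from the numerator is vacuous for k ≠ 0. -/
lemma exponentAt_eq_minimalExponent (p : b.support) {k : ℕ} (hk : k ≠ 0) (l : ℕ) :
    exponentAt b p k l = minimalExponent b p k l := by
  have h1 : ∀ w, denominatorCount b p w k l = count b p (inversions b w) k (l - 1) := by
    intro w
    refine congrArg Finset.card (Finset.filter_congr fun i _ => ?_)
    refine and_congr Iff.rfl ?_
    rw [eq_sub_iff_add_eq]; rfl
  have h2 : ∀ w, numeratorCount b p w k l = count b p (inversions b w) k l := by
    intro w
    rw [numeratorCount, count]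
    congr 1
    ext i
    simp only [Finset.mem_filter]
    refine and_congr_right fun _ => ⟨fun h => h.2, fun h => ⟨fun h' => hk ?_, h⟩⟩
    have h3 : level b p i = 0 := IsLevi.level_eq_zero h'
    have := h.1.symm.trans h3
    exact_mod_cast this
  rw [exponentAt, minimalExponent]
  simp_rw [h1, h2]

namespace IsOpposition

variable {p : b.support} {u v w : P.weylGroup} {g : P.Aut} {ϖ : Equiv.Perm b.support}
  (h : IsOpposition p u v g ϖ)
include h

/-- At level k ≠ 0, `v` maps the inversions of u w v onto the non-inversions of `w` and reflects the
height l to c_p k - l. -/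
lemma count_add_count (w : P.weylGroup) {k : ℝ} (hk : k ≠ 0) (l : ℝ) :
    count b p (inversions b (u * w * v)) k l +
      count b p (inversions b w) k (center b p * k - l) =
      count b p (posRoots b) k (center b p * k - l) := by
  classical
  have h1 : count b p (inversions b (u * w * v)) k l =
      count b p (posRoots b \ inversions b w) k (center b p * k - l) := by
    refine Finset.card_equiv (perm v) fun i => ?_
    simp only [Finset.mem_filter]
    rw [h.levi.coheight_perm]
    have h2 := h.mem_inversions_level_ne_zero (w := w) (i := i)
    constructor
    · rintro ⟨h3, h4, h5⟩
      refine ⟨(h2.1 ⟨h3, h4 ▸ hk⟩).1, by rw [h.levi.level_perm, h4], by rw [h4, h5]⟩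
    · rintro ⟨h3, h4, h5⟩
      refine ⟨(h2.2 ⟨h3, h4 ▸ hk⟩).1, by rw [← h.levi.level_perm, h4], ?_⟩
      rw [h.levi.level_perm] at h4
      rw [h4] at h5
      linarith
  rw [h1, count, count, count, ← Finset.card_union_of_disjoint, ← Finset.filter_union,
    Finset.sdiff_union_of_subset (inversions_subset w)]
  exact Finset.disjoint_filter_filter Finset.sdiff_disjoint

lemma count_posRoots {k : ℝ} (hk : k ≠ 0) (l : ℝ) :
    count b p (posRoots b) k (center b p * k - l) = count b p (posRoots b) k l := by
  refine (Finset.card_equiv (perm v) fun i => ?_).symm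
  simp only [Finset.mem_filter]
  rw [h.levi.coheight_perm, mem_posRoots, mem_posRoots, h.levi.level_perm]
  constructor
  · rintro ⟨h1, h2, h3⟩
    exact ⟨(h.levi.isPos_perm_iff (h2 ▸ hk)).2 h1, h2, by rw [h2, h3]⟩
  · rintro ⟨h1, h2, h3⟩
    refine ⟨(h.levi.isPos_perm_iff (h2 ▸ hk)).1 h1, h2, ?_⟩
    rw [h2] at h3
    linarith

/-- Take the inequality defining the exponent at `l` for u w v and replace both counts by
complements: it becomes the one for `w` at `l'`, shifted by counts of all positive roots. -/
lemma exponentAt_add_le {k : ℝ} (hk : k ≠ 0) {l l' : ℝ} (hl : l + l' = center b p * k + 1) :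
    exponentAt b p k l' + count b p (posRoots b) k l' ≤
      exponentAt b p k l + count b p (posRoots b) k (l' - 1) := by
  have key : ∀ w : P.weylGroup, Survives b p w →
      count b p (inversions b w) k (l' - 1) + count b p (posRoots b) k l' ≤
        exponentAt b p k l + count b p (posRoots b) k (l' - 1) +
          count b p (inversions b w) k l' := by
    intro w hw
    have h1 := exponentAt_spec p k l (h.survives.2 hw)
    have h2 := h.count_add_count w hk l
    have h3 := h.count_add_count w hk (l - 1)
    rw [show center b p * k - l = l' - 1 by linarith] at h2
    rw [show center b p * k - (l - 1) = l' by linarith] at h3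
    lia
  -- For w = 1 there are no inversions; the inequality left over shows that the truncated
  -- subtraction below is exact.
  have h1 := key 1 (survives_one p)
  rw [inversions_one, count_empty, count_empty] at h1
  have h2 : exponentAt b p k l' ≤ exponentAt b p k l + count b p (posRoots b) k (l' - 1) -
      count b p (posRoots b) k l' := exponentAt_le fun w hw => by
    have := key w hw
    lia
  lia

/-- The inequality is applied in both directions; the symmetry of the root counts under l ↦ c_p k -
l turns the two into an equality. -/
lemma exponentAt_add {k : ℝ} (hk : k ≠ 0) (l : ℝ) :
    exponentAt b p k (center b p * k + 1 - l) + count b p (posRoots b) k (l - 1) =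
      exponentAt b p k l + count b p (posRoots b) k l := by
  have h1 := h.exponentAt_add_le hk (l := l) (l' := center b p * k + 1 - l) (by ring)
  have h2 := h.exponentAt_add_le hk (l := center b p * k + 1 - l) (l' := l) (by ring)
  have h3 := h.count_posRoots hk (l - 1)
  have h4 := h.count_posRoots hk l
  rw [show center b p * k - (l - 1) = center b p * k + 1 - l by ring] at h3
  rw [show center b p * k + 1 - l - 1 = center b p * k - l by ring] at h1
  lia

end IsOpposition

end Exponents

end

/-! ### The minimal factor -/

section

variable {ι V N : Type*} [Fintype ι] [AddCommGroup V] [Module ℝ V] [AddCommGroup N] [Module ℝ N]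
  {P : RootPairing ι ℝ V N} [P.IsRootSystem] [P.IsCrystallographic] [P.IsReduced] {b : P.Base}

section MinimalFactor

variable (b) in
/-- `minimalExponent` as a function of an integral height. -/
def minExp (p : b.support) (x : ℕ × ℤ) : ℕ :=
  if 2 ≤ x.2 then minimalExponent b p x.1 x.2.toNat else 0

variable (b) in
/-- The number of positive roots of given non-zero level and given height. -/
def rootCount (p : b.support) (x : ℕ × ℤ) : ℕ :=
  if x.1 = 0 then 0 else count b p (posRoots b) x.1 x.2

variable (b) in
/-- The level and the height of a root. -/
def levelHeight (p : b.support) (i : ι) : ℕ × ℤ := (⌊level b p i⌋₊, ⌊coheight b i⌋)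

lemma levelHeight_fst {p : b.support} {i : ι} (hi : b.IsPos i) :
    (((levelHeight b p i).1 : ℕ) : ℝ) = level b p i := by
  obtain ⟨f, hf⟩ := exists_level_eq_nat b hi
  simp [levelHeight, hf]

lemma levelHeight_snd {p : b.support} {i : ι} :
    (((levelHeight b p i).2 : ℤ) : ℝ) = coheight b i := by
  obtain ⟨n, hn⟩ := exists_coheight_eq_int b i
  simp [levelHeight, hn]

lemma levelHeight_eq_iff {p : b.support} {i : ι} (hi : b.IsPos i) (x : ℕ × ℤ) :
    levelHeight b p i = x ↔ level b p i = x.1 ∧ coheight b i = x.2 := by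
  rw [Prod.ext_iff, ← levelHeight_fst hi, ← levelHeight_snd (p := p)]
  norm_cast

lemma rootCount_eq (p : b.support) (x : ℕ × ℤ) : rootCount b p x =
    ((posRoots b).filter fun i => level b p i ≠ 0 ∧ levelHeight b p i = x).card := by
  classical
  rw [rootCount]
  split_ifs with hx
  · symm
    rw [Finset.card_eq_zero, Finset.filter_eq_empty_iff]
    rintro i hi ⟨h1, rfl⟩
    rw [← levelHeight_fst ((mem_posRoots b).1 hi), hx] at h1
    exact h1 Nat.cast_zero
  · rw [count]
    congr 1
    ext i
    simp only [Finset.mem_filter]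
    refine and_congr_right fun hi => ?_
    rw [levelHeight_eq_iff ((mem_posRoots b).1 hi)]
    refine ⟨fun h => ⟨?_, h⟩, fun h => h.2⟩
    rw [h.1]
    exact_mod_cast hx

lemma exists_of_minimalExponent_ne_zero {p : b.support} {k h : ℕ}
    (hm : minimalExponent b p k h ≠ 0) :
    ∃ i ∈ posRoots b, level b p i = k ∧ coheight b i + 1 = h := by
  by_contra hno
  refine hm (Nat.le_zero.1 (Nat.sInf_le fun w _ => ?_))
  have : denominatorCount b p w k h = 0 := by
    rw [denominatorCount, Finset.card_eq_zero, Finset.filter_eq_empty_iff]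
    exact fun i hi h' => hno ⟨i, inversions_subset w hi, h'⟩
  rw [this]
  exact Nat.zero_le _

lemma minExp_mem {p : b.support} {x : ℕ × ℤ} (hx : minExp b p x ≠ 0) :
    ∃ i ∈ posRoots b, x = ((levelHeight b p i).1, (levelHeight b p i).2 + 1) := by
  rw [minExp] at hx
  split_ifs at hx with h2
  · obtain ⟨i, hi, h3, h4⟩ := exists_of_minimalExponent_ne_zero hx
    refine ⟨i, hi, ?_⟩
    have h5 := (levelHeight_eq_iff ((mem_posRoots b).1 hi) (p := p) (x.1, x.2 - 1)).2
      ⟨h3, by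
        have : ((x.2.toNat : ℕ) : ℝ) = x.2 := by
          have : ((x.2.toNat : ℕ) : ℤ) = x.2 := Int.toNat_of_nonneg (by lia)
          exact_mod_cast this
        rw [this] at h4
        push_cast
        linarith⟩
    rw [h5]; ext <;> simp
  · exact absurd rfl hx

lemma finite_minExp (p : b.support) : (Function.support (minExp b p)).Finite := by
  refine ((posRoots b).finite_toSet.image
    fun i => ((levelHeight b p i).1, (levelHeight b p i).2 + 1)).subset fun x hx => ?_
  obtain ⟨i, hi, rfl⟩ := minExp_mem hx
  exact ⟨i, hi, rfl⟩

lemma finite_rootCount (p : b.support) : (Function.support (rootCount b p)).Finite := by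
  refine ((posRoots b).finite_toSet.image (levelHeight b p)).subset fun x hx => ?_
  rw [Function.mem_support, rootCount_eq, Finset.card_ne_zero] at hx
  obtain ⟨i, hi⟩ := hx
  rw [Finset.mem_filter] at hi
  exact ⟨i, hi.1, hi.2.2⟩

lemma finite_mulSupport_pow {α : Type*} {e : α → ℕ} (he : (Function.support e).Finite)
    (f : α → ℂ) : (Function.mulSupport fun x => f x ^ e x).Finite :=
  he.subset fun x hx h => hx (by simp only [h, pow_zero])

/-- The cut-off at height 2 loses nothing: below it, a root counted in a denominator would have a
coroot of height less than 1. -/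
lemma minExp_eq_exponentAt (p : b.support) {x : ℕ × ℤ} (hx : x.1 ≠ 0) :
    minExp b p x = exponentAt b p x.1 x.2 := by
  rw [minExp]
  split_ifs with h2
  · rw [← exponentAt_eq_minimalExponent p hx]
    congr 1
    have : ((x.2.toNat : ℕ) : ℤ) = x.2 := Int.toNat_of_nonneg (by lia)
    exact_mod_cast this
  · rw [exponentAt_eq_zero]
    apply count_eq_zero_of_lt_one
    have : (x.2 : ℝ) ≤ 1 := by exact_mod_cast (by lia : x.2 ≤ 1)
    linarith

/-- Integral heights are used because h ↦ k c_p + 1 - h need not preserve the range h ≥ 2. -/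
lemma finprod_minimalExponent (p : b.support) (s : ℂ) :
    ∏ᶠ (kh : ℕ × ℕ) (_ : 2 ≤ kh.2), xi (kh.1 * s + kh.2) ^ minimalExponent b p kh.1 kh.2 =
      ∏ᶠ x : ℕ × ℤ, xi (x.1 * s + x.2) ^ minExp b p x := by
  let e : ℕ × ℕ → ℕ × ℤ := fun x => (x.1, x.2)
  have he : Function.Injective e := fun x y h => by
    simp only [e, Prod.mk.injEq] at h
    ext
    · exact h.1
    · exact_mod_cast h.2
  have h1 : ∀ kh : ℕ × ℕ, 2 ≤ kh.2 →
      xi (kh.1 * s + kh.2) ^ minimalExponent b p kh.1 kh.2 =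
        (fun x : ℕ × ℤ => xi (x.1 * s + x.2) ^ minExp b p x) (e kh) := by
    intro kh h2
    simp only [e, minExp]
    rw [if_pos (by exact_mod_cast h2)]
    simp
  rw [finprod_congr fun kh => finprod_congr_Prop rfl (h1 kh)]
  have h3 := finprod_mem_image (f := fun x : ℕ × ℤ => xi (x.1 * s + x.2) ^ minExp b p x)
    (s := {kh : ℕ × ℕ | 2 ≤ kh.2}) (g := e) he.injOn
  refine h3.symm.trans ?_
  rw [← finprod_mem_univ fun x : ℕ × ℤ => xi (x.1 * s + x.2) ^ minExp b p x]
  refine finprod_mem_inter_mulSupport_eq _ _ _ ?_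
  rw [Set.univ_inter, Set.inter_eq_right]
  intro x hx
  have hx' : 2 ≤ x.2 := by
    by_contra h2
    exact hx (by simp only [minExp, if_neg h2, pow_zero])
  have hx2 : ((x.2.toNat : ℕ) : ℤ) = x.2 := Int.toNat_of_nonneg (by lia)
  exact ⟨(x.1, x.2.toNat), by simp only [Set.mem_ofPred_eq]; lia, Prod.ext rfl hx2⟩

open Classical in
lemma prod_level_ne_zero (p : b.support) (f : ℕ × ℤ → ℂ) :
    ∏ i ∈ posRoots b with level b p i ≠ 0, f (levelHeight b p i) =
      ∏ᶠ x : ℕ × ℤ, f x ^ rootCount b p x := by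
  classical
  rw [Finset.prod_comp, finprod_eq_prod_of_mulSupport_subset
    (s := ((posRoots b).filter fun i => level b p i ≠ 0).image (levelHeight b p))]
  · refine Finset.prod_congr rfl fun x _ => ?_
    rw [rootCount_eq, Finset.filter_filter]
  · intro x hx
    have : rootCount b p x ≠ 0 := fun h0 => hx (by simp only [h0, pow_zero])
    rw [rootCount_eq, Finset.card_ne_zero] at this
    obtain ⟨i, hi⟩ := this
    rw [Finset.mem_filter] at hi
    exact Finset.mem_coe.2 (Finset.mem_image.2 ⟨i, Finset.mem_filter.2 ⟨hi.1, hi.2.1⟩, hi.2.2⟩)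

variable (b) in
/-- The minimal factor of Weng's zeta function. -/
def minimalFactor (p : b.support) (s : ℂ) : ℂ :=
  ∏ᶠ (kh : ℕ × ℕ) (_ : 2 ≤ kh.2), xi (kh.1 * s + kh.2) ^ minimalExponent b p kh.1 kh.2

/-- The involution `(k, h) ↦ (k, kc + 1 - h)` at positive levels. -/
def flipHeight (c : ℤ) : Equiv.Perm (ℕ × ℤ) :=
  Function.Involutive.toPerm (fun x => (x.1, if x.1 = 0 then x.2 else c * x.1 + 1 - x.2))
    (fun x => by ext <;> simp only []; split_ifs <;> ring)

lemma flipHeight_of_eq_zero (c : ℤ) {x : ℕ × ℤ} (hx : x.1 = 0) : flipHeight c x = x :=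
  Prod.ext rfl (if_pos hx)

lemma flipHeight_of_ne_zero (c : ℤ) {x : ℕ × ℤ} (hx : x.1 ≠ 0) :
    flipHeight c x = (x.1, c * x.1 + 1 - x.2) :=
  Prod.ext rfl (if_neg hx)

namespace IsOpposition

variable {p : b.support} {u v w : P.weylGroup} {g : P.Aut} {ϖ : Equiv.Perm b.support}
  (h : IsOpposition p u v g ϖ)
include h

/-- c_p is one more than the height of the coroot of v α_p. -/
lemma exists_center_eq : ∃ c : ℤ, center b p = c := by
  obtain ⟨n, hn⟩ := exists_coheight_eq_int b (perm v p)
  refine ⟨n + 1, ?_⟩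
  have := h.levi.coheight_perm p
  rw [level_self, coheight_support, hn] at this
  push_cast
  linarith

lemma minExp_flipHeight {c : ℤ} (hc : center b p = c) (x : ℕ × ℤ) :
    minExp b p (flipHeight c x) + rootCount b p (x.1, x.2 - 1) =
      minExp b p x + rootCount b p x := by
  by_cases hx : x.1 = 0
  · rw [flipHeight_of_eq_zero c hx, rootCount, rootCount, if_pos hx, if_pos hx]
  · rw [flipHeight_of_ne_zero c hx, minExp_eq_exponentAt p hx, minExp_eq_exponentAt p (x := (x.1, c * x.1 + 1 - x.2)) hx, rootCount,
      rootCount, if_neg hx, if_neg hx]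
    have := h.exponentAt_add (k := x.1) (by exact_mod_cast hx) x.2
    rw [hc] at this
    push_cast
    exact this

lemma xi_flipHeight {c : ℤ} (hc : center b p = c) (s : ℂ) (x : ℕ × ℤ) :
    xi ((flipHeight c x).1 * (-(center b p : ℂ) - s) + (flipHeight c x).2) =
      xi (x.1 * s + x.2) := by
  by_cases hx : x.1 = 0
  · rw [flipHeight_of_eq_zero c hx, hx]
    simp
  · rw [flipHeight_of_ne_zero c hx, hc, xi, xi, ← completedRiemannZeta_one_sub]
    congr 1
    push_cast
    ring

open Classical in
-- By ξ(1 - z) = ξ(z), the substitution s ↦ -c_p - s permutes the factors ξ(ks + h) by `flipHeight`;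
-- factors with k = 0 are constants. It remains to compare exponents factor by factor.
lemma minimalFactor_mul_prod (s : ℂ) :
    minimalFactor b p (-(center b p : ℂ) - s) *
      ∏ i ∈ posRoots b with level b p i ≠ 0, xi (arg b p i s + 1) =
    minimalFactor b p s * ∏ i ∈ posRoots b with level b p i ≠ 0, xi (arg b p i s) := by
  obtain ⟨c, hc⟩ := h.exists_center_eq
  have harg : ∀ i ∈ posRoots b,
      arg b p i s = (levelHeight b p i).1 * s + (levelHeight b p i).2 := fun i hi => by
    rw [arg, ← levelHeight_fst ((mem_posRoots b).1 hi), ← levelHeight_snd (p := p)]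
    push_cast; rfl
  have hA : ∏ i ∈ posRoots b with level b p i ≠ 0, xi (arg b p i s) =
      ∏ᶠ x : ℕ × ℤ, xi (x.1 * s + x.2) ^ rootCount b p x := by
    rw [← prod_level_ne_zero p fun x => xi (x.1 * s + x.2)]
    exact Finset.prod_congr rfl fun i hi => by rw [harg i (Finset.mem_filter.1 hi).1]
  -- The factor ξ(ks + h) in the shifted product comes from roots of height h - 1.
  let e : Equiv.Perm (ℕ × ℤ) := Equiv.prodCongr (Equiv.refl _) (Equiv.subRight 1)
  have hB : ∏ i ∈ posRoots b with level b p i ≠ 0, xi (arg b p i s + 1) =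
      ∏ᶠ x : ℕ × ℤ, xi (x.1 * s + x.2) ^ rootCount b p (e x) := by
    have h1 : ∏ i ∈ posRoots b with level b p i ≠ 0, xi (arg b p i s + 1) =
        ∏ᶠ x : ℕ × ℤ, xi (x.1 * s + x.2 + 1) ^ rootCount b p x := by
      rw [← prod_level_ne_zero p fun x => xi (x.1 * s + x.2 + 1)]
      exact Finset.prod_congr rfl fun i hi => by rw [harg i (Finset.mem_filter.1 hi).1]
    rw [h1, ← finprod_comp_equiv e]
    refine finprod_congr fun x => ?_
    congr 2
    simp only [e, Equiv.prodCongr_apply, Prod.map, Equiv.refl_apply, Equiv.subRight_apply]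
    push_cast
    ring
  have hD : minimalFactor b p (-(center b p : ℂ) - s) =
      ∏ᶠ x : ℕ × ℤ, xi (x.1 * s + x.2) ^ minExp b p (flipHeight c x) := by
    rw [minimalFactor, finprod_minimalExponent, ← finprod_comp_equiv (flipHeight c)]
    exact finprod_congr fun x => by rw [h.xi_flipHeight hc]
  have fin_comp : ∀ (f : ℕ × ℤ → ℕ) (e : Equiv.Perm (ℕ × ℤ)), (Function.support f).Finite →
      (Function.support fun x => f (e x)).Finite := fun f e hf =>
    hf.preimage e.injective.injOn
  rw [hA, hB, hD, minimalFactor, finprod_minimalExponent, ← finprod_mul_distrib, ← finprod_mul_distrib]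
  · refine finprod_congr fun x => ?_
    rw [← pow_add, ← pow_add]
    exact congrArg _ (h.minExp_flipHeight hc x)
  · exact finite_mulSupport_pow (finite_minExp p) _
  · exact finite_mulSupport_pow (finite_rootCount p) _
  · exact finite_mulSupport_pow (fin_comp _ _ (finite_minExp p)) _
  · exact finite_mulSupport_pow (fin_comp _ _ (finite_rootCount p)) _

open Classical in
/-- The functional equation for the closed form. -/
lemma residueSum_mul_minimalFactor (T : N) (s : ℂ) (hs : ∀ i ∈ posRoots b, level b p i ≠ 0 →
      xi (arg b p i s) ≠ 0 ∧ xi (arg b p i s + 1) ≠ 0) :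
    residueSum b p (autN b ϖ T) (-(center b p : ℂ) - s) *
        minimalFactor b p (-(center b p : ℂ) - s) =
      residueSum b p T s * minimalFactor b p s := by
  have h1 := h.residueSum_mul_prod T s hs
  have h2 := h.minimalFactor_mul_prod s
  have hA : ∏ i ∈ posRoots b with level b p i ≠ 0, xi (arg b p i s) ≠ 0 :=
    Finset.prod_ne_zero_iff.2 fun i hi =>
      (hs i (Finset.mem_filter.1 hi).1 (Finset.mem_filter.1 hi).2).1
  have hB : ∏ i ∈ posRoots b with level b p i ≠ 0, xi (arg b p i s + 1) ≠ 0 :=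
    Finset.prod_ne_zero_iff.2 fun i hi =>
      (hs i (Finset.mem_filter.1 hi).1 (Finset.mem_filter.1 hi).2).2
  refine mul_right_cancel₀ (mul_ne_zero hA hB) ?_
  linear_combination (minimalFactor b p (-(center b p : ℂ) - s) *
    ∏ i ∈ posRoots b with level b p i ≠ 0, xi (arg b p i s + 1)) * h1 +
    (residueSum b p T s * ∏ i ∈ posRoots b with level b p i ≠ 0, xi (arg b p i s + 1)) * h2

end IsOpposition

end MinimalFactor

end

/-! ### Transport by diagram automorphisms -/

section

variable {ι V N : Type*} [Fintype ι] [AddCommGroup V] [Module ℝ V] [AddCommGroup N] [Module ℝ N]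
  {P : RootPairing ι ℝ V N} [P.IsRootSystem] [P.IsCrystallographic] [P.IsReduced] {b : P.Base}

section Transport

lemma conj_reflection (g : P.Aut) (i : ι) : g * RootPairing.Equiv.reflection P i * g⁻¹ =
    RootPairing.Equiv.reflection P (g.indexEquiv i) := by
  rw [mul_inv_eq_iff_eq_mul]
  apply RootPairing.Equiv.weightHom_injective P
  ext x
  change g • (RootPairing.Equiv.reflection P i • x) =
    RootPairing.Equiv.reflection P (g.indexEquiv i) • (g • x)
  rw [RootPairing.Equiv.reflection_smul, RootPairing.Equiv.reflection_smul,
    RootPairing.reflection_apply, RootPairing.reflection_apply, smul_sub, aut_smul_smul,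
    root_indexEquiv]
  congr 2
  exact (toLinearMap_aut_smul_coroot g x i).symm

/-- Conjugating a reflection by an automorphism gives the reflection in the image root. Normality
lets conjugation reindex the sum over the Weyl group. -/
instance normal_weylGroup : P.weylGroup.Normal where
  conj_mem w hw g := by
    induction hw using RootPairing.weylGroup.induction with
    | mem i => rw [conj_reflection]; exact P.reflection_mem_weylGroup _
    | one => rw [mul_one, mul_inv_cancel]; exact one_mem _
    | mul x y hx hy h1 h2 =>
      have : g * (x * y) * g⁻¹ = (g * x * g⁻¹) * (g * y * g⁻¹) := by group
      rw [this]
      exact mul_mem h1 h2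

/-- Conjugation by an automorphism of the root system. -/
def conj (g : P.Aut) : Equiv.Perm P.weylGroup := (MulAut.conjNormal g).toEquiv

lemma conj_smul (g : P.Aut) (w : P.weylGroup) (x : V) : conj g w • (g • x) = g • (w • x) := by
  change (g * (w : P.Aut) * g⁻¹) • (g • x) = g • ((w : P.Aut) • x)
  rw [smul_smul, smul_smul, inv_mul_cancel_right]

lemma perm_conj (g : P.Aut) (w : P.weylGroup) (i : ι) :
    perm (conj g w) (g.indexEquiv i) = g.indexEquiv (perm w i) := P.root.injective <| by
  rw [root_perm, root_indexEquiv, root_indexEquiv, conj_smul, root_perm]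

namespace Extends

variable {g : P.Aut} {ϖ : Equiv.Perm b.support} (hg : Extends g ϖ)
include hg

lemma survives (p : b.support) (w : P.weylGroup) :
    Survives b (ϖ p) (conj g w) ↔ Survives b p w := by
  rw [survives_iff, survives_iff]
  constructor
  · intro H i hi
    have := H _ ((hg.isLevi_indexEquiv p i).2 hi)
    rwa [perm_conj, hg.mem_support_indexEquiv, hg.isPos_indexEquiv] at this
  · intro H i hi
    obtain ⟨i, rfl⟩ := g.indexEquiv.surjective i
    rw [perm_conj, hg.mem_support_indexEquiv, hg.isPos_indexEquiv]
    exact H i ((hg.isLevi_indexEquiv p i).1 hi)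

lemma mem_inversions (w : P.weylGroup) (i : ι) :
    g.indexEquiv i ∈ inversions b (conj g w) ↔ i ∈ inversions b w := by
  rw [Weng.mem_inversions, Weng.mem_inversions, perm_conj, hg.isPos_indexEquiv,
    hg.isPos_indexEquiv]

lemma arg (p : b.support) (i : ι) (s : ℂ) :
    Weng.arg b (ϖ p) (g.indexEquiv i) s = Weng.arg b p i s := by
  rw [Weng.arg, Weng.arg, hg.level_indexEquiv, hg.coheight_indexEquiv]

lemma exponent (p : b.support) (w : P.weylGroup) (y : N) (s : ℂ) :
    Weng.exponent b (ϖ p) (conj g w) (autN b ϖ y) s = Weng.exponent b p w y s := by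
  have h1 : conj g w • rho b - rho b = g • (w • rho b - rho b) := by
    rw [smul_sub, ← conj_smul, hg.smul_rho]
  rw [Weng.exponent, Weng.exponent, ← hg.smul_fundamentalWeight, conj_smul, h1,
    hg.toLinearMap_smul, hg.toLinearMap_smul]

open Classical in
lemma xiRatio (p : b.support) (w : P.weylGroup) (s : ℂ) :
    Weng.xiRatio b (ϖ p) (conj g w) s = Weng.xiRatio b p w s := by
  rw [Weng.xiRatio, Weng.xiRatio]
  congr 1
  · refine (Finset.prod_equiv g.indexEquiv (fun i => ?_) fun i _ => by rw [hg.arg]).symm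
    rw [Finset.mem_filter, Finset.mem_filter, hg.mem_inversions, hg.isLevi_indexEquiv]
  · refine (Finset.prod_equiv g.indexEquiv (fun i => ?_) fun i _ => by rw [hg.arg]).symm
    rw [hg.mem_inversions]

open Classical in
lemma term (p : b.support) (T : N) (s : ℂ) (w : P.weylGroup) :
    Weng.term b (ϖ p) (autN b ϖ T) s (conj g w) = Weng.term b p T s w := by
  rw [Weng.term, Weng.term, hg.exponent, hg.xiRatio]
  congr 2
  refine (Finset.prod_equiv g.indexEquiv (fun i => ?_) fun i _ => ?_).symm
  · rw [Finset.mem_filter, Finset.mem_filter, hg.mem_support_indexEquiv]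
    obtain ⟨j, rfl⟩ := (perm w).surjective i
    rw [← perm_conj, Equiv.symm_apply_apply, Equiv.symm_apply_apply, hg.isLevi_indexEquiv]
  · rw [← hg.autN_coroot, hg.exponent]

open Classical in
lemma residueSum (p : b.support) (T : N) (s : ℂ) :
    Weng.residueSum b (ϖ p) (autN b ϖ T) s = Weng.residueSum b p T s := by
  rw [Weng.residueSum, Weng.residueSum, ← finsum_comp_equiv (conj g)]
  exact finsum_congr fun w => if_congr (hg.survives p w) (hg.term p T s w) rfl

lemma minimalExponent (p : b.support) (k h : ℕ) :
    Weng.minimalExponent b (ϖ p) k h = Weng.minimalExponent b p k h := by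
  classical
  have h1 : ∀ w, denominatorCount b (ϖ p) (conj g w) k h = denominatorCount b p w k h := by
    intro w
    refine (Finset.card_equiv g.indexEquiv fun i => ?_).symm
    rw [Finset.mem_filter, Finset.mem_filter, hg.mem_inversions]
    have h2 := hg.level_indexEquiv p i
    have h3 := hg.coheight_indexEquiv i
    simp only [level, coheight] at h2 h3
    rw [h2, h3]
  have h2 : ∀ w, numeratorCount b (ϖ p) (conj g w) k h = numeratorCount b p w k h := by
    intro w
    refine (Finset.card_equiv g.indexEquiv fun i => ?_).symm
    rw [Finset.mem_filter, Finset.mem_filter, hg.mem_inversions]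
    have h2 := hg.level_indexEquiv p i
    have h3 := hg.coheight_indexEquiv i
    have h4 := hg.isLevi_indexEquiv p i
    simp only [level, coheight, IsLevi] at h2 h3 h4
    rw [h2, h3, h4]
  rw [Weng.minimalExponent, Weng.minimalExponent]
  congr 1
  ext m
  refine (conj g).forall_congr_right.symm.trans (forall_congr' fun w => ?_)
  rw [hg.survives, h1, h2]

lemma minimalFactor (p : b.support) (s : ℂ) :
    Weng.minimalFactor b (ϖ p) s = Weng.minimalFactor b p s := by
  simp only [Weng.minimalFactor, hg.minimalExponent]

end Extends

end Transport

end

/-! ### Residues and the completed zeta function -/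

section

/-! ### Iterated residues at simple poles -/

section Residues

/-- By Cauchy's formula the circle integral does not depend on the radius once it is small. -/
lemma residue_eq_of_div {f g : ℂ → ℂ} {R : ℝ} (hR : 0 < R)
    (hg : DifferentiableOn ℂ g (Metric.ball 0 R))
    (hf : ∀ z ∈ Metric.ball (0 : ℂ) R, z ≠ 0 → f z = g z / z) : residue f 0 = g 0 := by
  refine Filter.Tendsto.limUnder_eq (tendsto_nhds_of_eventually_eq ?_)
  filter_upwards [Ioo_mem_nhdsGT hR] with r hr
  have h1 : ∮ z in C(0, r), f z = ∮ z in C(0, r), (z - 0)⁻¹ • g z := by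
    refine circleIntegral.integral_congr hr.1.le fun z hz => ?_
    have hz' : ‖z‖ = r := by simpa using hz
    have hz0 : z ≠ 0 := norm_pos_iff.1 (hz' ▸ hr.1)
    rw [hf z (by simpa [hz'] using hr.2) hz0, sub_zero, smul_eq_mul, div_eq_inv_mul]
  have h2 : DifferentiableOn ℂ g (Metric.closedBall 0 r) :=
    hg.mono (Metric.closedBall_subset_ball hr.2)
  rw [h1, h2.circleIntegral_sub_inv_smul (Metric.mem_ball_self hr.1), smul_eq_mul,
    inv_mul_cancel_left₀ Complex.two_pi_I_ne_zero]

open Classical in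
/-- The iterated residue of a function with at most simple poles along coordinate hyperplanes. -/
lemma iteratedResidue_eq {κ : Type*} [Finite κ] (l : List κ) (hl : l.Nodup) :
    ∀ (U : Set (κ → ℂ)) (F g : (κ → ℂ) → ℂ), IsOpen U → DifferentiableOn ℂ g U →
      (∀ t ∈ U, (∀ k ∈ l, t k ≠ 0) → F t = g t / (l.map t).prod) →
      ∀ s ∈ U, (∀ k ∈ l, s k = 0) → iteratedResidue F l s = g s := by
  have := Fintype.ofFinite κ
  induction l with
  | nil =>
    intro U F g _ _ hF s hs _
    simpa [iteratedResidue] using hF s hs (by simp)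
  | cons k l ih =>
    intro U F g hU hg hF s hs hs0
    obtain ⟨hkl, hl⟩ := List.nodup_cons.1 hl
    have hsk : Function.update s k 0 = s := Function.update_eq_self_iff.2 (hs0 k (by simp)).symm
    have hupd : Differentiable ℂ fun z : ℂ => Function.update s k z := by
      rw [differentiable_pi]
      intro j
      by_cases hj : j = k
      · subst hj; simp only [Function.update_self]; fun_prop
      · simp only [Function.update_of_ne hj]; fun_prop
    have hopen : IsOpen ((fun z : ℂ => Function.update s k z) ⁻¹' U) :=
      hU.preimage hupd.continuous
    obtain ⟨R, hR, hball⟩ := Metric.isOpen_iff.1 hopen 0 (by simpa [hsk] using hs)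
    -- Where t_k ≠ 0 the factor 1/t_k is holomorphic and joins `g`. The induction hypothesis on this
    -- smaller open set gives the inner residues, hence its generality in `U` and `g`.
    have hU' : IsOpen (U ∩ {t | t k ≠ 0}) :=
      hU.inter (isOpen_ne_fun (continuous_apply k) continuous_const)
    have hdiv : DifferentiableOn ℂ (fun t : κ → ℂ => g t / t k) (U ∩ {t | t k ≠ 0}) := by
      simp only [div_eq_mul_inv]
      exact (hg.mono Set.inter_subset_left).fun_mul
        ((differentiable_apply k).differentiableOn.fun_inv fun t ht => ht.2)
    have key := residue_eq_of_div (f := fun z => iteratedResidue F l (Function.update s k z))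
      (g := fun z => g (Function.update s k z)) hR
      (hg.comp hupd.differentiableOn hball) (fun z hz hz0 => by
        rw [ih hl _ F (fun t => g t / t k) hU' hdiv ?_ _ ⟨hball hz, by simpa using hz0⟩ ?_]
        · simp
        · rintro t ⟨ht, htk⟩ htl
          rw [hF t ht (by
            intro j hj
            rcases List.mem_cons.1 hj with rfl | hj
            · exact htk
            · exact htl j hj), List.map_cons, List.prod_cons, div_div]
        · intro j hj
          change Function.update s k z j = 0
          rw [Function.update_of_ne fun h : j = k => hkl (h ▸ hj)]
          exact hs0 j (List.mem_cons_of_mem _ hj))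
    simp only [hsk] at key
    exact key

end Residues

/-! ### Poles and zeros of ξ -/

section Xi

/-- The entire function `(z - 1) ξ(z)`, away from `0`. -/
def xiSubOne (z : ℂ) : ℂ := (z - 1) * completedRiemannZeta₀ z - (z - 1) / z + 1

lemma xi_eq_div {z : ℂ} (hz : z ≠ 1) : xi z = xiSubOne z / (z - 1) := by
  have h1 : z - 1 ≠ 0 := sub_ne_zero.2 hz
  have h2 : (1 : ℂ) - z ≠ 0 := sub_ne_zero.2 hz.symm
  rw [xi, xiSubOne, completedRiemannZeta_eq, eq_div_iff h1]
  have : 1 / (1 - z) * (z - 1) = -1 := by field_simp; ring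
  rw [sub_mul, this]
  ring

/-- ξ has residue 1 at 1, so the factors over Φ_w ∩ Δ_p leave no constant in the closed form. -/
lemma xiSubOne_one : xiSubOne 1 = 1 := by simp [xiSubOne]

lemma analyticAt_completedRiemannZeta₀ (z : ℂ) : AnalyticAt ℂ completedRiemannZeta₀ z :=
  differentiable_completedZeta₀.analyticAt z

lemma analyticAt_xiSubOne {z : ℂ} (hz : z ≠ 0) : AnalyticAt ℂ xiSubOne z := by
  have := analyticAt_completedRiemannZeta₀ z
  exact (((analyticAt_id.sub analyticAt_const).mul this).sub
    ((analyticAt_id.sub analyticAt_const).div analyticAt_id hz)).add analyticAt_const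

lemma analyticAt_xi {z : ℂ} (h0 : z ≠ 0) (h1 : z ≠ 1) : AnalyticAt ℂ xi z := by
  have h : (fun z => xiSubOne z / (z - 1)) =ᶠ[𝓝 z] xi := by
    filter_upwards [isOpen_ne.mem_nhds h1] with w hw
    exact (xi_eq_div hw).symm
  exact ((analyticAt_xiSubOne h0).fun_div (analyticAt_id.sub analyticAt_const)
    (sub_ne_zero.2 h1)).congr h

lemma meromorphicAt_xi (z : ℂ) : MeromorphicAt xi z := by
  have : xi = fun z => completedRiemannZeta₀ z - 1 / z - 1 / (1 - z) :=
    funext completedRiemannZeta_eq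
  rw [this]
  have := (analyticAt_completedRiemannZeta₀ z).meromorphicAt
  fun_prop

lemma xi_ne_zero_of_one_lt {r : ℝ} (hr : 1 < r) : xi r ≠ 0 := by
  intro h
  have h0 : (r : ℂ) ≠ 0 := by exact_mod_cast (by linarith : r ≠ 0)
  have := riemannZeta_ne_zero_of_one_lt_re (s := r) (by simpa using hr)
  rw [riemannZeta_def_of_ne_zero h0] at this
  exact this (by rw [show completedRiemannZeta (r : ℂ) = 0 from h, zero_div])

lemma eventually_ne_nhdsNE (a z : ℂ) : ∀ᶠ w in 𝓝[≠] z, w ≠ a := by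
  by_cases haz : a = z
  · subst haz; exact self_mem_nhdsWithin
  · exact nhdsWithin_le_nhds (isOpen_ne.mem_nhds (Ne.symm haz))

lemma eventually_xi_ne_zero (z : ℂ) : ∀ᶠ w in 𝓝[≠] z, xi w ≠ 0 := by
  -- This is w(1 - w)ξ(w) with its poles cleared: an entire function with value -1 at 0, so its
  -- zeros are isolated.
  let H : ℂ → ℂ := fun w => w * (1 - w) * completedRiemannZeta₀ w - 1
  have hH : AnalyticOnNhd ℂ H Set.univ := fun w _ =>
    ((analyticAt_id.mul (analyticAt_const.sub analyticAt_id)).mul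
      (analyticAt_completedRiemannZeta₀ w)).sub analyticAt_const
  have hne : ∀ᶠ w in 𝓝[≠] z, H w ≠ 0 := by
    by_contra hcon
    have := hH.eqOn_zero_of_preconnected_of_frequently_eq_zero isPreconnected_univ
      (Set.mem_univ z) (fun h => hcon h) (Set.mem_univ 0)
    simp [H] at this
  filter_upwards [hne, eventually_ne_nhdsNE 0 z, eventually_ne_nhdsNE 1 z] with w h h0 h1 hxi
  apply h
  have h1' : (1 : ℂ) - w ≠ 0 := sub_ne_zero.2 h1.symm
  have h2 : completedRiemannZeta₀ w = 1 / w + 1 / (1 - w) := by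
    have := completedRiemannZeta_eq w
    rw [show completedRiemannZeta w = 0 from hxi] at this
    linear_combination -this
  simp only [H, h2]
  field_simp
  ring

lemma tendsto_affine_nhdsNE {a : ℂ} (ha : a ≠ 0) (c z : ℂ) :
    Filter.Tendsto (fun s => a * s + c) (𝓝[≠] z) (𝓝[≠] (a * z + c)) := by
  refine tendsto_nhdsWithin_of_tendsto_nhds_of_eventually_within _ ?_ ?_
  · exact (Continuous.tendsto (by fun_prop) z).mono_left nhdsWithin_le_nhds
  · filter_upwards [self_mem_nhdsWithin] with s hs h
    apply hs
    have h' : a * s + c = a * z + c := h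
    simpa [ha] using h'

lemma mem_codiscrete_of_eventually {S : Set ℂ} (h : ∀ z, ∀ᶠ s in 𝓝[≠] z, s ∈ S) :
    S ∈ Filter.codiscrete ℂ := by
  rw [mem_codiscrete]
  intro z
  rw [Filter.disjoint_principal_right, compl_compl]
  exact h z

end Xi

end

/-! ### The iterated residue of the period -/

section

variable {ι V N : Type*} [Fintype ι] [AddCommGroup V] [Module ℝ V] [AddCommGroup N] [Module ℝ N]
  {P : RootPairing ι ℝ V N} [P.IsRootSystem] [P.IsCrystallographic] [P.IsReduced] {b : P.Base}

section Coordinates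

variable (b) in
/-- `⟨λ, α_i^∨⟩` in the coordinates `t`. -/
def argC (i : ι) (t : b.support → ℂ) : ℂ := coheight b i + ∑ k, t k * level b k i

variable (b) in
/-- `⟨wλ - ρ, y⟩` in the coordinates `t`. -/
def exponentC (w : P.weylGroup) (y : N) (t : b.support → ℂ) : ℂ :=
  (P.toLinearMap (w • rho b - rho b) y : ℝ) +
    ∑ k, t k * (P.toLinearMap (w • fundamentalWeight b k) y : ℝ)

lemma pairC_point (t : b.support → ℂ) (i : ι) :
    pairC P (point b t) (P.coroot i) = argC b i t := by
  have hadd : ∀ x y : ℂ ⊗[ℝ] V, pairC P (x + y) (P.coroot i) =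
      pairC P x (P.coroot i) + pairC P y (P.coroot i) := fun x y => by simp [pairC]
  have hsum : ∀ f : b.support → ℂ ⊗[ℝ] V, pairC P (∑ k, f k) (P.coroot i) =
      ∑ k, pairC P (f k) (P.coroot i) := fun f => by simp [pairC]
  rw [point, hadd, hsum, argC, pairC_tmul, mul_one]
  simp_rw [pairC_tmul, mul_comm _ (t _)]
  rfl

lemma pairC_actC_point (w : P.weylGroup) (t : b.support → ℂ) (y : N) :
    pairC P (actC w (point b t) - 1 ⊗ₜ[ℝ] rho b) y = exponentC b w y t := by
  have hadd : ∀ x y' : ℂ ⊗[ℝ] V, pairC P (x + y') y = pairC P x y + pairC P y' y :=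
    fun x y => by simp [pairC]
  have hsum : ∀ f : b.support → ℂ ⊗[ℝ] V, pairC P (∑ k, f k) y = ∑ k, pairC P (f k) y :=
    fun f => by simp [pairC]
  have hact : actC w (point b t) - 1 ⊗ₜ[ℝ] rho b =
      1 ⊗ₜ[ℝ] (w • rho b - rho b) + ∑ k, t k ⊗ₜ[ℝ] (w • fundamentalWeight b k) := by
    have h : ∀ (z : ℂ) (x : V), actC w (z ⊗ₜ[ℝ] x) = z ⊗ₜ[ℝ] (w • x) := fun z x => rfl
    rw [point, map_add, map_sum, h, TensorProduct.tmul_sub]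
    simp_rw [h]
    abel
  rw [hact, hadd, hsum, exponentC, pairC_tmul, mul_one]
  simp_rw [pairC_tmul, mul_comm _ (t _)]

/-- For a simple root `α_i`, `⟨wλ - ρ, α_i^∨⟩ = ⟨λ, (w⁻¹α_i)^∨⟩ - 1`. -/
lemma exponentC_coroot (w : P.weylGroup) {i : ι} (hi : i ∈ b.support) (t : b.support → ℂ) :
    exponentC b w (P.coroot i) t = argC b ((perm w).symm i) t - 1 := by
  have h : ∀ x : V, P.toLinearMap (w • x) (P.coroot i) =
      P.toLinearMap x (P.coroot ((perm w).symm i)) := fun x => by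
    rw [← toLinearMap_smul_coroot w x, Equiv.apply_symm_apply]
  have h1 : P.toLinearMap (rho b) (P.coroot i) = 1 := coheight_support b ⟨i, hi⟩
  rw [exponentC, argC, map_sub, LinearMap.sub_apply, h1]
  simp_rw [h]
  simp only [coheight, level]
  push_cast
  ring

lemma argC_support (k : b.support) (t : b.support → ℂ) : argC b k t = t k + 1 := by
  rw [argC, coheight_support, Finset.sum_eq_single k]
  · rw [level_self]; push_cast; ring
  · intro j _ hj
    rw [level_support, if_neg hj.symm]; simp
  · simp

open Classical in
lemma argC_single (p : b.support) (i : ι) (s : ℂ) : argC b i (Pi.single p s) = arg b p i s := by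
  rw [argC, arg, Finset.sum_eq_single p]
  · rw [Pi.single_eq_same]; ring
  · intro k _ hk
    rw [Pi.single_eq_of_ne hk, zero_mul]
  · simp

open Classical in
lemma exponentC_single (p : b.support) (w : P.weylGroup) (y : N) (s : ℂ) :
    exponentC b w y (Pi.single p s) = exponent b p w y s := by
  rw [exponentC, exponent, Finset.sum_eq_single p]
  · rw [Pi.single_eq_same]; ring
  · intro k _ hk
    rw [Pi.single_eq_of_ne hk, zero_mul]
  · simp

lemma analyticAt_argC (i : ι) (t : b.support → ℂ) : AnalyticAt ℂ (argC b i) t := by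
  refine analyticAt_const.add (Finset.analyticAt_fun_sum _ fun k _ => ?_)
  exact ((ContinuousLinearMap.proj (R := ℂ) (φ := fun _ : b.support => ℂ) k).analyticAt t).mul
    analyticAt_const

lemma analyticAt_exponentC (w : P.weylGroup) (y : N) (t : b.support → ℂ) :
    AnalyticAt ℂ (exponentC b w y) t := by
  refine analyticAt_const.add (Finset.analyticAt_fun_sum _ fun k _ => ?_)
  exact ((ContinuousLinearMap.proj (R := ℂ) (φ := fun _ : b.support => ℂ) k).analyticAt t).mul
    analyticAt_const

end Coordinates

/-! ### Clearing the poles along Δ_p -/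

section Regularization

variable (b) in
/-- The term of `w` in the period. -/
def periodTerm (w : P.weylGroup) (T : N) (t : b.support → ℂ) : ℂ :=
  Complex.exp (exponentC b w T t) * (∏ i ∈ b.support, 1 / exponentC b w (P.coroot i) t) *
    ∏ i ∈ inversions b w, xi (argC b i t) / xi (argC b i t + 1)

lemma period_point (t : b.support → ℂ) (T : N) :
    period b (point b t) T = ∑ᶠ w, periodTerm b w T t := by
  rw [period]
  refine finsum_congr fun w => ?_
  simp only [periodTerm, pairC_point, pairC_actC_point]

open Classical in
variable (b) in
/-- The term of `w` in the period, multiplied by `∏ s_k` over `α_k ∈ Δ_p`. -/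
def regularTerm (p : b.support) (w : P.weylGroup) (T : N) (t : b.support → ℂ) : ℂ :=
  Complex.exp (exponentC b w T t) *
    (∏ i ∈ b.support with ¬ IsLevi b p ((perm w).symm i), (exponentC b w (P.coroot i) t)⁻¹) *
    ((∏ i ∈ inversions b w with ¬ IsLevi b p i, xi (argC b i t)) *
      (∏ i ∈ inversions b w, (xi (argC b i t + 1))⁻¹)) *
    (∏ i ∈ inversions b w with IsLevi b p i, xiSubOne (argC b i t)) *
    ∏ i ∈ b.support with IsLevi b p i ∧ perm w i ∉ b.support ∧ b.IsPos (perm w i),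
      (argC b i t - 1)

open Classical in
-- An element β of Δ_p has wβ simple, negative, or positive and not simple. Its coordinate cancels a
-- rational pole, cancels the pole of ξ, or survives as a zero, respectively.
lemma prod_levi_split (p : b.support) (w : P.weylGroup) (f : ι → ℂ) :
    ∏ i ∈ b.support with IsLevi b p i, f i =
      (∏ i ∈ b.support with IsLevi b p ((perm w).symm i), f ((perm w).symm i)) *
      (∏ i ∈ inversions b w with IsLevi b p i, f i) *
      ∏ i ∈ b.support with IsLevi b p i ∧ perm w i ∉ b.support ∧ b.IsPos (perm w i), f i := by
  have h1 : ∏ i ∈ b.support with IsLevi b p ((perm w).symm i), f ((perm w).symm i) =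
      ∏ i ∈ b.support with IsLevi b p i ∧ perm w i ∈ b.support, f i := by
    refine Finset.prod_equiv (perm w).symm (fun i => ?_) fun _ _ => rfl
    simp only [Finset.mem_filter, Equiv.apply_symm_apply]
    exact ⟨fun ⟨h, h'⟩ => ⟨h'.1, h', h⟩, fun ⟨_, h', h⟩ => ⟨h, h'⟩⟩
  have h2 : ∏ i ∈ inversions b w with IsLevi b p i, f i =
      ∏ i ∈ b.support with IsLevi b p i ∧ ¬ b.IsPos (perm w i), f i := by
    refine Finset.prod_congr (Finset.ext fun i => ?_) fun _ _ => rfl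
    simp only [Finset.mem_filter]
    rw [mem_inversions]
    exact ⟨fun ⟨h, h'⟩ => ⟨h'.1, h', h.2⟩, fun ⟨h, h', h''⟩ =>
      ⟨⟨RootPairing.Base.isPos_of_mem_support h, h''⟩, h'⟩⟩
  rw [h1, h2]
  simp only [Finset.prod_filter]
  rw [← Finset.prod_mul_distrib, ← Finset.prod_mul_distrib]
  refine Finset.prod_congr rfl fun i _ => ?_
  have h3 : perm w i ∈ b.support → b.IsPos (perm w i) :=
    fun h => RootPairing.Base.isPos_of_mem_support h
  by_cases hl : IsLevi b p i <;> by_cases hs : perm w i ∈ b.support <;>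
    by_cases hp : b.IsPos (perm w i) <;> simp_all

open Classical in
lemma regularTerm_eq (p : b.support) (w : P.weylGroup) (T : N) (t : b.support → ℂ)
    (ht : ∀ i, IsLevi b p i → argC b i t ≠ 1) :
    regularTerm b p w T t =
      periodTerm b w T t * ∏ i ∈ b.support with IsLevi b p i, (argC b i t - 1) := by
  have hA : ∏ i ∈ b.support, 1 / exponentC b w (P.coroot i) t =
      (∏ i ∈ b.support with IsLevi b p ((perm w).symm i), (argC b ((perm w).symm i) t - 1))⁻¹ *
      ∏ i ∈ b.support with ¬ IsLevi b p ((perm w).symm i),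
        (exponentC b w (P.coroot i) t)⁻¹ := by
    rw [← Finset.prod_filter_mul_prod_filter_not b.support
      (fun i => IsLevi b p ((perm w).symm i)), ← Finset.prod_inv_distrib]
    congr 1
    · refine Finset.prod_congr rfl fun i hi => ?_
      rw [exponentC_coroot w (Finset.mem_filter.1 hi).1, one_div]
    · simp only [one_div]
  have hB : ∏ i ∈ inversions b w, xi (argC b i t) / xi (argC b i t + 1) =
      (∏ i ∈ inversions b w with IsLevi b p i, xiSubOne (argC b i t)) *
      (∏ i ∈ inversions b w with IsLevi b p i, (argC b i t - 1))⁻¹ *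
      ((∏ i ∈ inversions b w with ¬ IsLevi b p i, xi (argC b i t)) *
        (∏ i ∈ inversions b w, (xi (argC b i t + 1))⁻¹)) := by
    simp_rw [div_eq_mul_inv]
    rw [Finset.prod_mul_distrib, ← Finset.prod_filter_mul_prod_filter_not (inversions b w)
      (fun i => IsLevi b p i) fun i => xi (argC b i t), ← Finset.prod_inv_distrib,
      ← Finset.prod_mul_distrib, mul_assoc]
    congr 1
    refine Finset.prod_congr rfl fun i hi => ?_
    rw [xi_eq_div (ht i (Finset.mem_filter.1 hi).2), div_eq_mul_inv]
  have hne1 : ∏ i ∈ b.support with IsLevi b p ((perm w).symm i),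
      (argC b ((perm w).symm i) t - 1) ≠ 0 := Finset.prod_ne_zero_iff.2 fun i hi =>
    sub_ne_zero.2 (ht _ (Finset.mem_filter.1 hi).2)
  have hne2 : ∏ i ∈ inversions b w with IsLevi b p i, (argC b i t - 1) ≠ 0 :=
    Finset.prod_ne_zero_iff.2 fun i hi => sub_ne_zero.2 (ht _ (Finset.mem_filter.1 hi).2)
  rw [periodTerm, regularTerm, hA, hB, prod_levi_split p w fun i => argC b i t - 1]
  field_simp

variable (b) in
/-- The conditions under which the terms have no singularities except for the obvious ones. -/
structure IsGeneric (p : b.support) (s : ℂ) : Prop where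
  arg_ne : ∀ i ∈ posRoots b, ¬ IsLevi b p i → arg b p i s ≠ 0 ∧ arg b p i s ≠ 1 ∧ arg b p i s ≠ -1
  xi_add_one : ∀ i ∈ posRoots b, xi (arg b p i s + 1) ≠ 0
  xi_ne : ∀ i ∈ posRoots b, level b p i ≠ 0 → xi (arg b p i s) ≠ 0

lemma arg_neg (p : b.support) (i : ι) (s : ℂ) : arg b p (neg P i) s = -arg b p i s := by
  simp only [arg, level_neg, coheight_neg]
  push_cast
  ring

lemma IsLevi.arg_eq_one {p : b.support} {i : ι} (h : IsLevi b p i) (s : ℂ) : arg b p i s = 1 := by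
  simp [arg, h.level_eq_zero, h.coheight_eq_one]

/-- The rational factors involve w⁻¹α for simple α, which may be negative; this is why genericity
also excludes -1 at positive roots. -/
lemma IsGeneric.arg_ne_one {p : b.support} {s : ℂ} (h : IsGeneric b p s) {i : ι}
    (hi : ¬ IsLevi b p i) : arg b p i s ≠ 1 := by
  by_cases hpos : b.IsPos i
  · exact (h.arg_ne i ((mem_posRoots b).2 hpos) hi).2.1
  · intro h1
    have h2 : arg b p (neg P i) s = -1 := by rw [arg_neg, h1]
    by_cases hl : IsLevi b p (neg P i)
    · rw [hl.arg_eq_one] at h2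
      norm_num at h2
    · exact (h.arg_ne _ ((mem_posRoots b).2 ((isPos_neg_iff b i).2 hpos)) hl).2.2 h2

open Classical in
lemma analyticAt_regularTerm {p : b.support} {s : ℂ} (h : IsGeneric b p s) (w : P.weylGroup)
    (T : N) : AnalyticAt ℂ (regularTerm b p w T) (Pi.single p s) := by
  have harg : ∀ i, AnalyticAt ℂ (argC b i) (Pi.single p s) := fun i => analyticAt_argC i _
  refine ((((analyticAt_exponentC w T _).cexp.mul ?_).mul (.mul ?_ ?_)).mul ?_).mul ?_
  · refine Finset.analyticAt_fun_prod _ fun i hi => (analyticAt_exponentC w _ _).inv ?_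
    rw [Finset.mem_filter] at hi
    rw [exponentC_coroot w hi.1, argC_single, sub_ne_zero]
    exact h.arg_ne_one hi.2
  · refine Finset.analyticAt_fun_prod _ fun i hi => ?_
    rw [Finset.mem_filter] at hi
    have := h.arg_ne i (inversions_subset w hi.1) hi.2
    refine AnalyticAt.fun_comp (analyticAt_xi ?_ ?_) (harg i)
    · rw [argC_single]; exact this.1
    · rw [argC_single]; exact this.2.1
  · refine Finset.analyticAt_fun_prod _ fun i hi => ?_
    have hi' := inversions_subset w hi
    -- On Δ_p the shifted argument is 2; elsewhere genericity excludes 0 and -1 before the shift.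
    have hne : arg b p i s + 1 ≠ 0 ∧ arg b p i s + 1 ≠ 1 := by
      by_cases hl : IsLevi b p i
      · rw [hl.arg_eq_one]; norm_num
      · obtain ⟨h0, -, h2⟩ := h.arg_ne i hi' hl
        exact ⟨fun h' => h2 (eq_neg_of_add_eq_zero_left h'), fun h' => h0 (by simpa using h')⟩
    refine AnalyticAt.inv (AnalyticAt.fun_comp (g := xi) (analyticAt_xi ?_ ?_)
      ((harg i).add analyticAt_const)) ?_
    · rw [argC_single]; exact hne.1
    · rw [argC_single]; exact hne.2
    · rw [argC_single]; exact h.xi_add_one i hi'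
  · refine Finset.analyticAt_fun_prod _ fun i hi => ?_
    rw [Finset.mem_filter] at hi
    refine AnalyticAt.fun_comp (analyticAt_xiSubOne ?_) (harg i)
    rw [argC_single, hi.2.arg_eq_one]
    exact one_ne_zero
  · exact Finset.analyticAt_fun_prod _ fun i _ => (harg i).sub analyticAt_const

open Classical in
lemma regularTerm_single (p : b.support) (w : P.weylGroup) (T : N) (s : ℂ) :
    regularTerm b p w T (Pi.single p s) = if Survives b p w then term b p T s w else 0 := by
  rw [regularTerm]
  simp only [argC_single, exponentC_single]
  split_ifs with hw
  · rw [survives_iff] at hw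
    have h1 : (b.support.filter fun i => IsLevi b p i ∧ perm w i ∉ b.support ∧
        b.IsPos (perm w i)) = ∅ := by
      rw [Finset.filter_eq_empty_iff]
      rintro i - ⟨hl, hs, hp⟩
      rcases hw i hl with h | h
      · exact hs h
      · exact h hp
    have h2 : ∏ i ∈ inversions b w with IsLevi b p i, xiSubOne (arg b p i s) = 1 :=
      Finset.prod_eq_one fun i hi => by
        rw [(Finset.mem_filter.1 hi).2.arg_eq_one, xiSubOne_one]
    rw [h1, h2, Finset.prod_empty, mul_one, mul_one, term, xiRatio, div_eq_mul_inv,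
      Finset.prod_inv_distrib, Finset.prod_inv_distrib]
    simp only [one_div, Finset.prod_inv_distrib]
  · rw [survives_iff] at hw
    push Not at hw
    obtain ⟨i, hl, hs, hp⟩ := hw
    have : ∏ i ∈ b.support with IsLevi b p i ∧ perm w i ∉ b.support ∧ b.IsPos (perm w i),
        (arg b p i s - 1) = 0 := Finset.prod_eq_zero
      (Finset.mem_filter.2 ⟨hl.1, hl, hs, hp⟩) (by rw [hl.arg_eq_one, sub_self])
    rw [this, mul_zero]

open Classical in
-- The sum of the regularized terms is analytic at the point and equals the period times the
-- coordinates in `l` off the hyperplanes, so `iteratedResidue_eq` evaluates it there.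
lemma residuePeriod_eq_residueSum {p : b.support} {l : List b.support} (hl : IsOrdering b p l)
    (T : N) {s : ℂ} (hs : IsGeneric b p s) :
    residuePeriod b p l T s = residueSum b p T s := by
  have := finite_weylGroup b
  have := Fintype.ofFinite P.weylGroup
  have han : AnalyticAt ℂ (fun t => ∑ w, regularTerm b p w T t) (Pi.single p s) :=
    Finset.analyticAt_fun_sum _ fun w _ => by
      convert analyticAt_regularTerm hs w T
  obtain ⟨U, hU, hUo, hsU⟩ := eventually_nhds_iff.1 han.eventually_analyticAt
  have key := iteratedResidue_eq l hl.1 U (fun t => period b (point b t) T)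
    (fun t => ∑ w, regularTerm b p w T t) hUo
    (fun t ht => (hU t ht).differentiableAt.differentiableWithinAt)
    (fun t _ htl => by
      have hprod : (l.map t).prod = ∏ i ∈ b.support with IsLevi b p i, (argC b i t - 1) := by
        rw [← List.prod_toFinset t hl.1, Finset.prod_filter, ← Finset.prod_coe_sort b.support]
        rw [← Finset.prod_filter]
        refine Finset.prod_congr (Finset.ext fun k => ?_) fun k _ => ?_
        · rw [List.mem_toFinset, hl.2, Finset.mem_filter]
          exact ⟨fun h => ⟨Finset.mem_univ k, k.2, fun h' => h (Subtype.ext h')⟩,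
            fun h h' => h.2.2 (congrArg Subtype.val h')⟩
        · rw [argC_support, add_sub_cancel_right]
      have hne : ∀ i, IsLevi b p i → argC b i t ≠ 1 := fun i hi h => by
        have h1 := argC_support ⟨i, hi.1⟩ t
        rw [h] at h1
        exact htl ⟨i, hi.1⟩ ((hl.2 _).2 fun h' => hi.2 (congrArg Subtype.val h'))
          (by simpa using h1)
      have hprodne : (l.map t).prod ≠ 0 := by
        rw [hprod]
        exact Finset.prod_ne_zero_iff.2 fun i hi =>
          sub_ne_zero.2 (hne i (Finset.mem_filter.1 hi).2)
      rw [eq_div_iff hprodne, period_point, finsum_eq_sum_of_fintype, Finset.sum_mul, hprod]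
      exact Finset.sum_congr rfl fun w _ => (regularTerm_eq p w T t hne).symm)
    (Pi.single p s) hsU (fun k hk => by
      rw [Pi.single_apply, if_neg ((hl.2 k).1 hk)])
  rw [residueSum, finsum_eq_sum_of_fintype]
  convert key using 1
  · rw [residuePeriod]
  · refine Finset.sum_congr rfl fun w _ => ?_
    convert (regularTerm_single p w T s).symm

end Regularization

end

/-! ### Meromorphy and functional equations -/

section

section Conclusion

variable {ι V N : Type*} [Fintype ι] [AddCommGroup V] [Module ℝ V] [AddCommGroup N] [Module ℝ N]
  {P : RootPairing ι ℝ V N} [P.IsRootSystem] [P.IsCrystallographic] [P.IsReduced] {b : P.Base}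

lemma tendsto_arg_nhdsNE {p : b.support} {i : ι} (h : level b p i ≠ 0) (c z : ℂ) :
    Filter.Tendsto (fun s => arg b p i s + c) (𝓝[≠] z) (𝓝[≠] (arg b p i z + c)) := by
  have := tendsto_affine_nhdsNE (Complex.ofReal_ne_zero.2 h) (coheight b i + c) z
  simpa only [arg, add_assoc] using this

/-- At non-zero level each condition fails only at isolated s. At level 0 the argument is a constant
integer n ≥ 1, equal to 1 only on Δ_p, and ξ(n + 1) ≠ 0. -/
lemma eventually_isGeneric (p : b.support) (z : ℂ) : ∀ᶠ s in 𝓝[≠] z, IsGeneric b p s := by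
  have key : ∀ᶠ s in 𝓝[≠] z, ∀ i ∈ posRoots b,
      (¬ IsLevi b p i → arg b p i s ≠ 0 ∧ arg b p i s ≠ 1 ∧ arg b p i s ≠ -1) ∧
      xi (arg b p i s + 1) ≠ 0 ∧ (level b p i ≠ 0 → xi (arg b p i s) ≠ 0) := by
    refine (Filter.eventually_all_finset _).2 fun i hi => ?_
    by_cases h : level b p i = 0
    · obtain ⟨n, hn, hc⟩ := exists_coheight_eq_nat b ((mem_posRoots b).1 hi)
      have harg : ∀ s, arg b p i s = n := fun s => by simp [arg, h, hc]
      refine Filter.Eventually.of_forall fun s => ?_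
      rw [harg]
      refine ⟨fun hl => ?_, ?_, fun h' => absurd h h'⟩
      · have hn1 : n ≠ 1 := fun h1 => hl (isLevi_iff.2 ⟨h, by rw [hc, h1, Nat.cast_one]⟩)
        refine ⟨by exact_mod_cast (show n ≠ 0 by lia), by exact_mod_cast hn1, fun h1 => ?_⟩
        have : ((n : ℤ) : ℂ) = ((-1 : ℤ) : ℂ) := by simpa using h1
        have := Int.cast_injective this
        lia
      · have := xi_ne_zero_of_one_lt (r := (n : ℝ) + 1) (by
          have : (1 : ℝ) ≤ n := by exact_mod_cast hn
          linarith)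
        simpa using this
    · have h0 : Filter.Tendsto (arg b p i) (𝓝[≠] z) (𝓝[≠] (arg b p i z)) := by
        simpa using tendsto_arg_nhdsNE h 0 z
      filter_upwards [h0.eventually (eventually_ne_nhdsNE 0 _),
        h0.eventually (eventually_ne_nhdsNE 1 _), h0.eventually (eventually_ne_nhdsNE (-1) _),
        h0.eventually (eventually_xi_ne_zero _),
        (tendsto_arg_nhdsNE h 1 z).eventually (eventually_xi_ne_zero _)] with s h1 h2 h3 h4 h5
      exact ⟨fun _ => ⟨h1, h2, h3⟩, h5, fun _ => h4⟩
  filter_upwards [key] with s hs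
  exact ⟨fun i hi => (hs i hi).1, fun i hi => (hs i hi).2.1, fun i hi => (hs i hi).2.2⟩

lemma meromorphicAt_xi_affine (a c z : ℂ) : MeromorphicAt (fun s => xi (a * s + c)) z :=
  MeromorphicAt.comp_analyticAt (f := xi) (g := fun s => a * s + c) (meromorphicAt_xi _)
    (by fun_prop)

lemma meromorphicAt_term (p : b.support) (T : N) (w : P.weylGroup) (z : ℂ) :
    MeromorphicAt (fun s => term b p T s w) z := by
  have hexp : ∀ y : N, AnalyticAt ℂ (exponent b p w y) z := fun y => by
    unfold exponent
    fun_prop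
  have hxi : ∀ i, MeromorphicAt (fun s => xi (arg b p i s)) z := fun i =>
    meromorphicAt_xi_affine _ _ _
  have hxi' : ∀ i, MeromorphicAt (fun s => xi (arg b p i s + 1)) z := fun i => by
    simpa only [arg, add_assoc] using meromorphicAt_xi_affine (level b p i) (coheight b i + 1) z
  unfold term xiRatio
  refine ((AnalyticAt.cexp (hexp T)).meromorphicAt.fun_mul ?_).fun_mul ?_
  · exact MeromorphicAt.fun_prod fun i _ =>
      (MeromorphicAt.const 1 z).fun_div (hexp _).meromorphicAt
  · exact (MeromorphicAt.fun_prod fun i _ => hxi i).fun_div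
      (MeromorphicAt.fun_prod fun i _ => hxi' i)

lemma meromorphicAt_residueSum (p : b.support) (T : N) (z : ℂ) :
    MeromorphicAt (residueSum b p T) z := by
  have := finite_weylGroup b
  have := Fintype.ofFinite P.weylGroup
  unfold residueSum
  simp_rw [finsum_eq_sum_of_fintype]
  refine MeromorphicAt.fun_sum fun w _ => ?_
  split_ifs
  · exact meromorphicAt_term p T w z
  · exact MeromorphicAt.const 0 z

lemma meromorphicAt_minimalFactor (p : b.support) (z : ℂ) :
    MeromorphicAt (minimalFactor b p) z := by
  have h : minimalFactor b p = fun s => ∏ x ∈ (finite_minExp (b := b) p).toFinset,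
      xi (x.1 * s + x.2) ^ minExp b p x := funext fun s => by
    rw [minimalFactor, finprod_minimalExponent]
    refine finprod_eq_prod_of_mulSupport_subset _ fun x hx => ?_
    rw [Set.Finite.coe_toFinset]
    intro h0
    exact hx (by simp only [h0, pow_zero])
  rw [h]
  exact MeromorphicAt.fun_prod fun x _ => (meromorphicAt_xi_affine _ _ _).fun_pow _

lemma wengZeta_eq {p : b.support} {l : List b.support} (hl : IsOrdering b p l) (T : N) {s : ℂ}
    (hs : IsGeneric b p s) :
    wengZeta b p l T s = residueSum b p T s * minimalFactor b p s := by
  rw [← residuePeriod_eq_residueSum hl T hs]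
  rfl

lemma meromorphic_wengZeta {p : b.support} {l : List b.support} (hl : IsOrdering b p l) (T : N) :
    Meromorphic (wengZeta b p l T) := fun z =>
  -- Equality on a punctured neighbourhood is enough, so values at non-generic s do not matter.
  ((meromorphicAt_residueSum p T z).fun_mul (meromorphicAt_minimalFactor p z)).congr <| by
    filter_upwards [eventually_isGeneric p z] with s hs
    exact (wengZeta_eq hl T hs).symm

lemma IsOpposition.wengZeta {p : b.support} {u v : P.weylGroup} {g : P.Aut}
    {ϖ : Equiv.Perm b.support} (h : IsOpposition p u v g ϖ) {l l' : List b.support}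
    (hl : IsOrdering b p l) (hl' : IsOrdering b p l') (T : N) :
    (fun s : ℂ => wengZeta b p l' (autN b ϖ T) (-(center b p : ℂ) - s))
      =ᶠ[Filter.codiscrete ℂ] fun s => wengZeta b p l T s :=
  mem_codiscrete_of_eventually fun z => by
    have ht : Filter.Tendsto (fun s : ℂ => -(center b p : ℂ) - s) (𝓝[≠] z)
        (𝓝[≠] (-(center b p : ℂ) - z)) := by
      have := tendsto_affine_nhdsNE (a := -1) (by norm_num) (-(center b p : ℂ)) z
      simpa only [neg_one_mul, neg_add_eq_sub] using this
    -- Both s and -c_p - s must be generic for the closed form to apply on both sides.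
    filter_upwards [eventually_isGeneric p z, ht.eventually (eventually_isGeneric p _)]
      with s hs hs'
    rw [wengZeta_eq hl T hs, wengZeta_eq hl' _ hs']
    exact h.residueSum_mul_minimalFactor T s fun i hi hi' =>
      ⟨hs.xi_ne i hi hi', hs.xi_add_one i hi⟩

lemma Extends.wengZeta {g : P.Aut} {ϖ : Equiv.Perm b.support} (hg : Extends g ϖ)
    {p : b.support} {l l' : List b.support} (hl : IsOrdering b p l)
    (hl' : IsOrdering b (ϖ p) l') (T : N) :
    (fun s : ℂ => wengZeta b p l T s)
      =ᶠ[Filter.codiscrete ℂ] fun s => wengZeta b (ϖ p) l' (autN b ϖ T) s :=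
  mem_codiscrete_of_eventually fun z => by
    filter_upwards [eventually_isGeneric p z, eventually_isGeneric (ϖ p) z] with s hs hs'
    rw [wengZeta_eq hl T hs, wengZeta_eq hl' _ hs', hg.residueSum, hg.minimalFactor]

end Conclusion

end

end Weng

end

theorem mainTheorem1 {ι V N : Type*} [Fintype ι]
    [AddCommGroup V] [Module ℝ V] [AddCommGroup N] [Module ℝ N]
    (P : RootPairing ι ℝ V N) [P.IsRootSystem] [P.IsCrystallographic] [P.IsReduced]
    (b : P.Base) (w₀ : P.weylGroup) (hw₀ : Weng.IsLongest b w₀)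
    (p : b.support) (l : List b.support) (hl : Weng.IsOrdering b p l) :
    (∀ T : N, Meromorphic (Weng.wengZeta b p l T)) ∧
    (∃ ϖ₀ : Equiv.Perm b.support, Weng.IsDiagramAut b ϖ₀ ∧
      (∀ x : V, Weng.autV b ϖ₀ (w₀ • x) = -x) ∧
      ∀ l' : List b.support, Weng.IsOrdering b p l' → ∀ T : N,
        (fun s : ℂ => Weng.wengZeta b p l' (Weng.autN b ϖ₀ T) (-(Weng.center b p : ℂ) - s))
          =ᶠ[Filter.codiscrete ℂ] fun s => Weng.wengZeta b p l T s) ∧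
    (∀ ϖ : Equiv.Perm b.support, Weng.IsDiagramAut b ϖ → ∀ q : b.support, q = ϖ p →
      ∀ l' : List b.support, Weng.IsOrdering b q l' → ∀ T : N,
        (fun s : ℂ => Weng.wengZeta b p l T s)
          =ᶠ[Filter.codiscrete ℂ] fun s => Weng.wengZeta b q l' (Weng.autN b ϖ T) s) := by
  refine ⟨fun T => Weng.meromorphic_wengZeta hl T, ?_, ?_⟩
  · obtain ⟨ϖ₀, hϖ₀, h⟩ := hw₀.exists_diagramAut
    obtain ⟨g, hg⟩ := hϖ₀.exists_extends
    obtain ⟨v, hv⟩ := Weng.exists_isLeviLongest b p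
    refine ⟨ϖ₀, hϖ₀, fun x => by rw [h, inv_smul_smul], fun l' hl' T => ?_⟩
    -- Here u = w₀⁻¹, because ϖ₀ = -w₀⁻¹ makes w₀⁻¹ act as -g.
    have hopp : Weng.IsOpposition p w₀⁻¹ v g ϖ₀ :=
      ⟨hv, hg, fun x => by rw [hg.smul, h, neg_neg]⟩
    exact hopp.wengZeta hl hl' T
  · rintro ϖ hϖ _ rfl l' hl' T
    obtain ⟨g, hg⟩ := hϖ.exists_extends
    exact hg.wengZeta hl hl' T
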